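/- Consider a $d$-dimensional periodic lattice ($d\ge 1$) with $L_i$ unit cells in direction $i$ (for $d=1$, a ring of length $L$), with a $q$-dimensional Hilbert space with basis $|0\rangle,\dots,|q-1\rangle$ at each unit cell and total Hilbert space the tensor product over all cells. Let $T_j$ be the unitary translation by one cell in direction $j$, $T_j|a\rangle=|a'\rangle$ with $a'_x=a_{x-e_j}$ on the product basis. A state $\psi\neq0$ has momentum $P\in\mathbb{R}$ along $j$ if $T_j\psi=e^{iP}\psi$. A local unitary of range $r$ and depth $D$ is a quantum circuit with at most $D$ layers, each layer a product of arbitrary unitary gates with pairwise disjoint supports, such that any two cells in the support of a gate are at periodic distance at most $r$ in every direction. A state is called long-range entangled at range $r$ and depth $D$ if no such local unitary maps it to a multiple of the product state $|00\dots0\rangle$. There is a universal constant $C$ such that for all $d\ge1$, all sizes $L_1,\dots,L_d\ge1$, all $q\ge1$, every direction $j$, and all $r,D\ge0$ with $C\,rD<L_j$ (that is, $\xi=rD\ll L_j$), the following hold. (1) Every state with momentum $P$ along $j$ such that $e^{iP}\neq1$ is long-range entangled at range $r$ and depth $D$. (2) (Equivalent formulation.) If $\psi$ has momentum $P$ along $j$,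 $U$ is a local unitary of range $r$ and depth $D$, and $U\psi$ has momentum $P'$ along $j$ with $e^{iP'}\neq e^{iP}$, then $\psi$ is long-range entangled at range $r$ and depth $D$. -/

import Mathlib

namespace SpinLattice

/-! ### Local unitaries on a finite set of sites -/

section Circuits

variable {X : Type} [Fintype X] [DecidableEq X] {q : ℕ}

/-- A basis configuration: a label `a x ∈ {0, …, q - 1}` for every site `x`.  The configurations
label the tensor product basis of the Hilbert space `⨂ x, ℂ^q`. -/
abbrev Config (X : Type) (q : ℕ) : Type := X → Fin q

/-- Vectors of `⨂ x, ℂ^q`, written through their amplitudes in the tensor product basis. -/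
abbrev StateVec (X : Type) (q : ℕ) : Type := Config X q → ℂ

/-- The un-entangled product state `|00…0⟩`. -/
def zeroState (X : Type) [Fintype X] [DecidableEq X] (q : ℕ) [NeZero q] : StateVec X q :=
  Pi.single (fun _ => 0) 1

/-- A gate: an arbitrary unitary on the tensor factors at the sites of a finite set `support`. -/
structure Gate (X : Type) [DecidableEq X] (q : ℕ) where
  support : Finset X
  unitary : Matrix.unitaryGroup (support → Fin q) ℂ

/-- The operator `u ⊗ 1` of a gate on the whole Hilbert space. -/
def Gate.toMatrix (g : Gate X q) : Matrix (Config X q) (Config X q) ℂ :=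
  Matrix.of fun a b =>
    if ∀ x, x ∉ g.support → a x = b x then
      (g.unitary : Matrix (g.support → Fin q) (g.support → Fin q) ℂ)
        (fun x => a x) (fun x => b x)
    else 0

/-- One layer of a circuit: gates with pairwise disjoint supports, acting simultaneously. -/
structure Layer (X : Type) [DecidableEq X] (q : ℕ) where
  gates : List (Gate X q)
  disjoint : gates.Pairwise fun g h => Disjoint g.support h.support

/-- The operator of a layer: the product of its (commuting) gates. -/
def Layer.toMatrix (l : Layer X q) : Matrix (Config X q) (Config X q) ℂ :=
  (l.gates.map Gate.toMatrix).prod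

/-- The operator of a circuit, a list of layers whose head acts first. -/
def circuitMatrix : List (Layer X q) → Matrix (Config X q) (Config X q) ℂ
  | [] => 1
  | l :: c => circuitMatrix c * l.toMatrix

end Circuits

/-! ### Periodic lattices -/

section Torus

variable {d : ℕ} {L : Fin d → ℕ} [∀ i, NeZero (L i)] {q : ℕ}

/-- The unit cells of a `d`-dimensional lattice with `L i` cells in direction `i` and periodic
boundary conditions; for `d = 1` a ring. -/
abbrev Torus {d : ℕ} (L : Fin d → ℕ) : Type := ∀ i, ZMod (L i)

/-- The distance of two cells along direction `i`, measured around the ring `ZMod (L i)`. -/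
def dirDist (x y : Torus L) (i : Fin d) : ℕ := (x i - y i).valMinAbs.natAbs

/-- The gate has range at most `r`: in every direction, any two cells of its support are at
distance at most `r`. -/
def Gate.HasRange (g : Gate (Torus L) q) (r : ℕ) : Prop :=
  ∀ x ∈ g.support, ∀ y ∈ g.support, ∀ i, dirDist x y i ≤ r

/-- `U` is the operator of a quantum circuit of at most `D` layers with gates of range at
most `r`. -/
def IsLocalUnitary (r D : ℕ) (U : Matrix (Config (Torus L) q) (Config (Torus L) q) ℂ) : Prop :=
  ∃ c : List (Layer (Torus L) q),
    c.length ≤ D ∧ (∀ l ∈ c, ∀ g ∈ l.gates, g.HasRange r) ∧ circuitMatrix c = U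

/-- `ψ` is long-range entangled with respect to circuits of range `r` and depth `D`: no such
circuit maps `ψ` to the product state `|00…0⟩`, not even up to a scalar. -/
def IsLongRangeEntangled [NeZero q] (r D : ℕ) (ψ : StateVec (Torus L) q) : Prop :=
  ¬ ∃ U : Matrix (Config (Torus L) q) (Config (Torus L) q) ℂ,
      IsLocalUnitary r D U ∧ ∃ z : ℂ, U.mulVec ψ = z • zeroState (Torus L) q

/-- Translation by one cell in direction `j`, the linear map that sends the basis vector `|a⟩` to
the basis vector `|a'⟩` with `a' x = a (x - e_j)`. -/
def latticeTranslate (j : Fin d) (ψ : StateVec (Torus L) q) : StateVec (Torus L) q :=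
  fun a => ψ fun x => a (x + Pi.single j 1)

/-- `ψ` is a state (a nonzero vector) with momentum `P` along direction `j`. -/
def HasMomentum (j : Fin d) (P : ℝ) (ψ : StateVec (Torus L) q) : Prop :=
  ψ ≠ 0 ∧ latticeTranslate j ψ = Complex.exp (P * Complex.I) • ψ

end Torus

end SpinLattice

/-! Suppose a shallow circuit `U` takes a translation eigenvector `ψ`, with eigenvalue `z` on a ring
of length `n`, to the product state. Exchanging an arc between two copies of the product state does
nothing, so the exchange conjugated by `U` fixes `ψ ⊗ ψ`. Gates inside the arc, applied to both
copies, commute with the exchange, and so do gates outside it; only gates near the two ends survive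
(`exists_lightCone`, `IsCircuit.exists_swapOp_conj`). Hence the exchange, dressed near its ends,
fixes `ψ ⊗ ψ`, and so does its translate by one cell. The product of the two is a product of an
operator at each end, whose expectation values multiply to 1 because far apart regions are
uncorrelated. Each factor has modulus at most 1, so each is a phase. The phase at the left end is 1
because it is also the expectation value of a conjugated exchange, a swap test and hence nonnegative
(`IsCircuit.exists_dressedSwap`).

The operator at one end needs two copies only of a short arc. For lack of correlations, a far
translate of that arc within a single copy of `ψ` serves as the second one
(`IsCircuit.expect_withImage`). The dressed exchange of the arc with its translate by `a` cells
takes `ψ` to a nonzero vector `χ`, and moving the end of the exchange by one cell does not change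
`χ`. This says that `χ` is an eigenvector, with the same eigenvalue `z`, of the translation composed
with the exchange of two slabs at distance `a`. That permutation of sites cuts the ring open and
reconnects it into rings of lengths `a` and `b = n - a`, so its power `a * b` is trivial
(`reconnect_pow_eq_one`) and `z ^ (a * b) = 1` (`IsCircuit.pow_mul_eq_one`).

Also `z ^ n = 1`. Both rings can be kept long with `a`, and hence `b`, coprime to `n`
(`exists_coprime_split`), so `z = 1` (`IsCircuit.eigenvalue_eq_one`). Locality is used only along
the direction of translation, so the dimension plays no role. -/

namespace SpinLattice

/-! ### Light cones of layered products in a group -/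

section LightCone

variable {G H : Type*} [Group G] [Monoid H]

/-- The product of a circuit whose layers are lists of group elements; the head acts first. -/
def layeredProd : List (List G) → G
  | [] => 1
  | l :: c => layeredProd c * l.prod

theorem layeredProd_append (c c' : List (List G)) :
    layeredProd (c ++ c') = layeredProd c' * layeredProd c := by
  induction c with
  | nil => simp [layeredProd]
  | cons l c ih => simp [layeredProd, ih, mul_assoc]

theorem layeredProd_inv (c : List (List G)) :
    (layeredProd c)⁻¹ = layeredProd (c.reverse.map fun l => (l.map (·⁻¹)).reverse) := by
  induction c with
  | nil => simp [layeredProd]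
  | cons l c ih =>
    rw [List.reverse_cons, List.map_append, layeredProd_append, ← ih]
    simp [layeredProd, List.prod_inv_reverse]

/-- Within a layer the order is immaterial, so the gates outside the light cone can be collected on
the left, next to the operator being conjugated, where they will cancel. -/
theorem exists_prod_split (p : G → Prop) (l : List G) (hl : l.Pairwise Commute) :
    ∃ lo li : List G, l.prod = lo.prod * li.prod ∧ (∀ g ∈ lo, g ∈ l ∧ ¬ p g) ∧
      ∀ g ∈ li, g ∈ l ∧ p g := by
  classical
  induction l with
  | nil => exact ⟨[], [], by simp⟩
  | cons g l ih =>
    rw [List.pairwise_cons] at hl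
    obtain ⟨lo, li, h, ho, hi⟩ := ih hl.2
    by_cases hg : p g
    · refine ⟨lo, g :: li, ?_, fun x hx => ⟨List.mem_cons_of_mem _ (ho x hx).1, (ho x hx).2⟩, ?_⟩
      · have : Commute g lo.prod := Commute.list_prod_right _ _ fun y hy => hl.1 y (ho y hy).1
        rw [List.prod_cons, List.prod_cons, h, ← mul_assoc, this.eq, mul_assoc]
      · intro x hx
        rcases List.mem_cons.1 hx with rfl | hx
        · exact ⟨List.mem_cons_self, hg⟩
        · exact ⟨List.mem_cons_of_mem _ (hi x hx).1, (hi x hx).2⟩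
    · refine ⟨g :: lo, li, ?_, ?_, fun x hx => ⟨List.mem_cons_of_mem _ (hi x hx).1, (hi x hx).2⟩⟩
      · rw [List.prod_cons, List.prod_cons, h, mul_assoc]
      · intro x hx
        rcases List.mem_cons.1 hx with rfl | hx
        · exact ⟨List.mem_cons_self, hg⟩
        · exact ⟨List.mem_cons_of_mem _ (ho x hx).1, (ho x hx).2⟩

/-- Light cone: if each gate either lies in the next of a growing sequence of regions or
commutes with `P` and the current region, then conjugating `P` by the circuit only involves the
last region. -/
theorem exists_lightCone (φ : G →* H) (P : H) (gen : ℕ → Set G) (hmono : Monotone gen) (D : ℕ)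
    (c : List (List G)) (hlen : c.length ≤ D) (hcomm : ∀ l ∈ c, l.Pairwise Commute)
    (hgate : ∀ l ∈ c, ∀ g ∈ l, ∀ k < D,
      g ∈ gen (k + 1) ∨ (Commute (φ g) P ∧ ∀ w ∈ gen k, Commute g w)) :
    ∃ C ∈ Submonoid.closure (gen c.length),
      φ (layeredProd c)⁻¹ * P * φ (layeredProd c) = φ C⁻¹ * P * φ C := by
  induction c with
  | nil => exact ⟨1, one_mem _, by simp [layeredProd]⟩
  | cons l c ih =>
    rw [List.length_cons] at hlen
    obtain ⟨C, hC, hCP⟩ := ih (by omega) (fun l hl => hcomm l (List.mem_cons_of_mem _ hl))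
      (fun l hl => hgate l (List.mem_cons_of_mem _ hl))
    -- The head of the list acts first, so it is the outermost layer of the conjugation; the tail
    -- has already been reduced to `C`. The gates in `lo` commute with both `C` and `P` and drop
    -- out, while those in `li` join `C`.
    obtain ⟨lo, li, hprod, ho, hi⟩ := exists_prod_split (· ∈ gen (c.length + 1)) l
      (hcomm l List.mem_cons_self)
    have hout : ∀ g ∈ lo, Commute (φ g) P ∧ ∀ w ∈ gen c.length, Commute g w := fun g hg =>
      (hgate l List.mem_cons_self g (ho g hg).1 c.length (by omega)).resolve_left (ho g hg).2
    have hloP : Commute (φ lo.prod) P := by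
      rw [map_list_prod]
      refine Commute.list_prod_left _ _ fun y hy => ?_
      obtain ⟨g, hg, rfl⟩ := List.mem_map.1 hy
      exact (hout g hg).1
    have hloC : Commute lo.prod C := by
      refine Commute.list_prod_left _ _ fun g hg => ?_
      clear hCP
      induction hC using Submonoid.closure_induction with
      | mem w hw => exact (hout g hg).2 w hw
      | one => exact Commute.one_right _
      | mul x y _ _ hx hy => exact (hx.mul_right hy)
    refine ⟨C * li.prod, mul_mem (Submonoid.closure_mono (hmono (Nat.le_succ _)) hC)
      (list_prod_mem fun g hg => Submonoid.subset_closure (hi g hg).2), ?_⟩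
    have h1 : φ (lo.prod)⁻¹ * φ lo.prod = 1 := by rw [← map_mul]; simp
    calc φ (layeredProd (l :: c))⁻¹ * P * φ (layeredProd (l :: c))
        = φ l.prod⁻¹ * (φ (layeredProd c)⁻¹ * P * φ (layeredProd c)) * φ l.prod := by
          simp only [layeredProd, mul_inv_rev, map_mul, mul_assoc]
      _ = φ l.prod⁻¹ * (φ C⁻¹ * P * φ C) * φ l.prod := by rw [hCP]
      _ = φ (C * l.prod)⁻¹ * P * φ (C * l.prod) := by
          simp only [mul_inv_rev, map_mul, mul_assoc]
      _ = φ (lo.prod * (C * li.prod))⁻¹ * P * φ (lo.prod * (C * li.prod)) := by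
          rw [hprod, ← mul_assoc C, ← hloC.eq, mul_assoc lo.prod]
      _ = φ (C * li.prod)⁻¹ * (φ (lo.prod)⁻¹ * (P * φ lo.prod)) * φ (C * li.prod) := by
          rw [mul_inv_rev, map_mul, map_mul φ lo.prod]
          simp only [mul_assoc]
      _ = φ (C * li.prod)⁻¹ * P * φ (C * li.prod) := by
          rw [← hloP.eq, ← mul_assoc (φ (lo.prod)⁻¹), h1, one_mul]

end LightCone

open Matrix

/-! ### Operators on part of the sites, and permutations of sites -/

section Embedding

set_option linter.unusedSectionVars false

theorem extend_extend_self {S Y β : Type} {f : S → Y} (hf : f.Injective) (s t : S → β) (a : Y → β) :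
    Function.extend f t (Function.extend f s a) = Function.extend f t a := by
  funext y
  by_cases hy : ∃ x, f x = y
  · obtain ⟨x, rfl⟩ := hy
    simp [hf.extend_apply]
  · simp [Function.extend_apply' _ _ _ hy]

variable {R S Y : Type} [Fintype R] [DecidableEq R] [Fintype S] [DecidableEq S] [Fintype Y]
  [DecidableEq Y] {q : ℕ}

/-- Operators on the Hilbert space of the sites `Y`. -/
abbrev Op (Y : Type) (q : ℕ) : Type := Matrix (Config Y q) (Config Y q) ℂ

open Classical in
/-- The operator on `Y` that acts as `M` on the sites `f s` and trivially on the others. -/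
noncomputable def embedOp (f : S → Y) (M : Op S q) : Op Y q :=
  Matrix.of fun a b => if ∀ y, y ∉ Set.range f → a y = b y then M (a ∘ f) (b ∘ f) else 0

/-- The operator that permutes the tensor factors by `σ`. -/
def permOp (σ : Equiv.Perm Y) : Op Y q :=
  Matrix.of fun a b => if a ∘ σ = b then 1 else 0

theorem op_ext {A B : Op Y q} (h : ∀ v, A *ᵥ v = B *ᵥ v) : A = B :=
  Matrix.toLin'.injective (LinearMap.ext fun v => by simpa using h v)

/-- A row of the embedded operator is nonzero only at configurations that agree with `a` off the
image of `f`, and these are determined by their labels `s` on the image. Working with this action on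
vectors avoids sums over matrix entries in the later identities. -/
theorem embedOp_mulVec {f : S → Y} (hf : f.Injective) (M : Op S q) (v : StateVec Y q)
    (a : Config Y q) :
    (embedOp f M *ᵥ v) a = ∑ s, M (a ∘ f) s * v (Function.extend f s a) := by
  classical
  simp only [mulVec, dotProduct, embedOp, of_apply, ite_mul, zero_mul]
  rw [← Finset.sum_filter]
  refine Finset.sum_nbij' (fun b => b ∘ f) (fun s => Function.extend f s a) ?_ ?_ ?_ ?_ ?_
  · simp
  · intro s _
    simp only [Finset.mem_filter, Finset.mem_univ, true_and]
    intro y hy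
    rw [Function.extend_apply' _ _ _ (by simpa using hy)]
  · intro b hb
    simp only [Finset.mem_filter, Finset.mem_univ, true_and] at hb
    funext y
    by_cases hy : y ∈ Set.range f
    · obtain ⟨s, rfl⟩ := hy
      rw [hf.extend_apply]; rfl
    · rw [Function.extend_apply' _ _ _ (by simpa using hy), hb y hy]
  · intro s _
    exact Function.extend_comp hf s a
  · intro b hb
    simp only [Finset.mem_filter, Finset.mem_univ, true_and] at hb
    congr 2
    funext y
    by_cases hy : y ∈ Set.range f
    · obtain ⟨s, rfl⟩ := hy
      rw [hf.extend_apply]; rfl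
    · rw [Function.extend_apply' _ _ _ (by simpa using hy), hb y hy]

theorem embedOp_mul {f : S → Y} (hf : f.Injective) (A B : Op S q) :
    embedOp f (A * B) = embedOp f A * embedOp f B := by
  refine op_ext fun v => funext fun a => ?_
  rw [← mulVec_mulVec, embedOp_mulVec hf, embedOp_mulVec hf]
  simp only [embedOp_mulVec hf, Function.extend_comp hf, extend_extend_self hf, Matrix.mul_apply,
    Finset.sum_mul, Finset.mul_sum, mul_assoc]
  exact Finset.sum_comm

theorem embedOp_one {f : S → Y} (hf : f.Injective) : embedOp f (1 : Op S q) = 1 := by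
  refine op_ext fun v => funext fun a => ?_
  rw [embedOp_mulVec hf, one_mulVec]
  have : Function.extend f (a ∘ f) a = a := by
    funext y
    by_cases hy : ∃ x, f x = y
    · obtain ⟨x, rfl⟩ := hy
      simp [hf.extend_apply]
    · simp [Function.extend_apply' _ _ _ hy]
  simp [Matrix.one_apply, this]

theorem embedOp_conjTranspose (f : S → Y) (A : Op S q) :
    embedOp f Aᴴ = (embedOp f A)ᴴ := by
  ext a b
  simp only [embedOp, of_apply, conjTranspose_apply]
  by_cases h : ∀ y, y ∉ Set.range f → a y = b y
  · rw [if_pos h, if_pos fun y hy => (h y hy).symm]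
  · rw [if_neg h, if_neg fun h' => h fun y hy => (h' y hy).symm, star_zero]

theorem embedOp_add (f : S → Y) (A B : Op S q) :
    embedOp f (A + B) = embedOp f A + embedOp f B := by
  ext a b
  simp only [embedOp, of_apply, Matrix.add_apply]
  split_ifs <;> simp

theorem embedOp_smul (f : S → Y) (z : ℂ) (A : Op S q) :
    embedOp f (z • A) = z • embedOp f A := by
  ext a b
  simp only [embedOp, of_apply, Matrix.smul_apply]
  split_ifs <;> simp

theorem embedOp_comp {g : R → S} {f : S → Y} (hf : f.Injective) (A : Op R q) :
    embedOp f (embedOp g A) = embedOp (f ∘ g) A := by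
  ext a b
  simp only [embedOp, of_apply, ← Function.comp_assoc]
  by_cases h : ∀ y, y ∉ Set.range (f ∘ g) → a y = b y
  · rw [if_pos h, if_pos, if_pos]
    · intro s hs
      refine h _ ?_
      rintro ⟨x, hx⟩
      exact hs ⟨x, hf hx⟩
    · intro y hy
      exact h y fun ⟨x, hx⟩ => hy ⟨g x, hx⟩
  · rw [if_neg h]
    split_ifs with h1 h2
    · refine absurd (fun y hy => ?_) h
      by_cases hy' : y ∈ Set.range f
      · obtain ⟨s, rfl⟩ := hy'
        exact h2 s fun ⟨x, hx⟩ => hy ⟨x, by simp [hx]⟩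
      · exact h1 y hy'
    · rfl
    · rfl

theorem embedOp_commute {f : S → Y} {g : R → Y} (hf : f.Injective) (hg : g.Injective)
    (hfg : ∀ s r, f s ≠ g r) (A : Op S q) (B : Op R q) :
    Commute (embedOp f A) (embedOp g B) := by
  refine op_ext fun v => funext fun a => ?_
  have h1 : ∀ s : Config S q, Function.extend f s a ∘ g = a ∘ g := fun s => by
    funext r
    exact Function.extend_apply' _ _ _ fun ⟨x, hx⟩ => hfg x r hx
  have h2 : ∀ s : Config R q, Function.extend g s a ∘ f = a ∘ f := fun s => by
    funext r
    exact Function.extend_apply' _ _ _ fun ⟨x, hx⟩ => hfg r x hx.symm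
  have h3 : ∀ (s : Config S q) (r : Config R q),
      Function.extend g r (Function.extend f s a) = Function.extend f s (Function.extend g r a) := by
    intro s r
    funext y
    by_cases hy : ∃ x, f x = y
    · obtain ⟨x, rfl⟩ := hy
      rw [hf.extend_apply, Function.extend_apply' _ _ _ fun ⟨z, hz⟩ => hfg x z hz.symm,
        hf.extend_apply]
    · rw [Function.extend_apply' (f := f) _ _ _ hy]
      by_cases hy' : ∃ x, g x = y
      · obtain ⟨x, rfl⟩ := hy'
        rw [hg.extend_apply, hg.extend_apply]
      · rw [Function.extend_apply' (f := g) _ _ _ hy', Function.extend_apply' (f := g) _ _ _ hy',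
          Function.extend_apply' (f := f) _ _ _ hy]
  rw [← mulVec_mulVec, ← mulVec_mulVec, embedOp_mulVec hf, embedOp_mulVec hg]
  simp only [embedOp_mulVec hg, embedOp_mulVec hf, h1, h2, h3, Finset.mul_sum]
  rw [Finset.sum_comm]
  refine Finset.sum_congr rfl fun r _ => Finset.sum_congr rfl fun s _ => ?_
  ring

theorem permOp_mulVec (σ : Equiv.Perm Y) (v : StateVec Y q) (a : Config Y q) :
    (permOp σ *ᵥ v) a = v (a ∘ σ) := by
  simp [permOp, mulVec, dotProduct]

theorem permOp_one : permOp (1 : Equiv.Perm Y) = (1 : Op Y q) :=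
  op_ext fun v => funext fun a => by rw [permOp_mulVec, one_mulVec]; rfl

theorem permOp_mul (σ τ : Equiv.Perm Y) : permOp (σ * τ) = permOp σ * (permOp τ : Op Y q) :=
  op_ext fun v => funext fun a => by
    rw [← mulVec_mulVec, permOp_mulVec, permOp_mulVec, permOp_mulVec]; rfl

theorem permOp_conjTranspose (σ : Equiv.Perm Y) : (permOp σ : Op Y q)ᴴ = permOp σ⁻¹ := by
  ext a b
  simp only [permOp, conjTranspose_apply, of_apply, apply_ite star, star_one, star_zero]
  refine if_congr ⟨fun h => ?_, fun h => ?_⟩ rfl rfl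
  · rw [← h]; funext y; simp
  · rw [← h]; funext y; simp

theorem permOp_mul_embedOp (σ : Equiv.Perm Y) {f : S → Y} (hf : f.Injective) (A : Op S q) :
    permOp σ * embedOp f A = embedOp (σ ∘ f) A * permOp σ := by
  refine op_ext fun v => funext fun a => ?_
  rw [← mulVec_mulVec, ← mulVec_mulVec, permOp_mulVec, embedOp_mulVec hf,
    embedOp_mulVec (σ.injective.comp hf)]
  refine Finset.sum_congr rfl fun s _ => ?_
  rw [permOp_mulVec]
  congr 2
  funext y
  by_cases hy : ∃ x, f x = y
  · obtain ⟨x, rfl⟩ := hy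
    rw [hf.extend_apply]
    exact ((σ.injective.comp hf).extend_apply s a x).symm
  · rw [Function.extend_apply' _ _ _ hy, Function.comp_apply, Function.comp_apply,
      Function.extend_apply']
    rintro ⟨x, hx⟩
    exact hy ⟨x, σ.injective hx⟩

/-- Used to realise one abstract exchange on `N ⊕ N` in two ways: between two copies of the system,
and between two regions of a single copy. -/
theorem embedOp_permOp {f : S → Y} (hf : f.Injective) {e : Equiv.Perm S} {e' : Equiv.Perm Y}
    (h : ∀ s, e' (f s) = f (e s)) (h' : ∀ y, y ∉ Set.range f → e' y = y) :
    embedOp f (permOp e) = (permOp e' : Op Y q) := by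
  refine op_ext fun v => funext fun a => ?_
  rw [embedOp_mulVec hf, permOp_mulVec]
  have : Function.extend f (a ∘ f ∘ e) a = a ∘ e' := by
    funext y
    by_cases hy : ∃ x, f x = y
    · obtain ⟨x, rfl⟩ := hy
      simp [hf.extend_apply, h]
    · rw [Function.extend_apply' _ _ _ hy, Function.comp_apply, h' y (by simpa using hy)]
  simp [permOp, ← this, Function.comp_assoc]

end Embedding

/-! ### Supports, and exchange operators on two copies -/

section Support

set_option linter.unusedSectionVars false

variable {X Y : Type} [Fintype X] [DecidableEq X] [Fintype Y] [DecidableEq Y] {q : ℕ}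

/-- The operator acts only on the sites of `S`. -/
def SupportedOn (S : Finset Y) (M : Op Y q) : Prop :=
  ∃ m : Op S q, embedOp (Subtype.val : S → Y) m = M

theorem SupportedOn.mono {S T : Finset Y} {M : Op Y q} (h : SupportedOn S M) (hST : S ⊆ T) :
    SupportedOn T M := by
  obtain ⟨m, rfl⟩ := h
  exact ⟨embedOp (fun s : S => ⟨s.1, hST s.2⟩) m, by
    rw [embedOp_comp Subtype.val_injective]; rfl⟩

theorem SupportedOn.one (S : Finset Y) : SupportedOn S (1 : Op Y q) :=
  ⟨1, embedOp_one Subtype.val_injective⟩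

theorem SupportedOn.mul {S : Finset Y} {M N : Op Y q} (hM : SupportedOn S M)
    (hN : SupportedOn S N) : SupportedOn S (M * N) := by
  obtain ⟨m, rfl⟩ := hM
  obtain ⟨n, rfl⟩ := hN
  exact ⟨m * n, embedOp_mul Subtype.val_injective _ _⟩

theorem SupportedOn.conjTranspose {S : Finset Y} {M : Op Y q} (hM : SupportedOn S M) :
    SupportedOn S Mᴴ := by
  obtain ⟨m, rfl⟩ := hM
  exact ⟨mᴴ, embedOp_conjTranspose _ _⟩

theorem SupportedOn.commute {S T : Finset Y} {M N : Op Y q} (hM : SupportedOn S M)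
    (hN : SupportedOn T N) (h : Disjoint S T) : Commute M N := by
  obtain ⟨m, rfl⟩ := hM
  obtain ⟨n, rfl⟩ := hN
  exact embedOp_commute Subtype.val_injective Subtype.val_injective
    (fun s t hst => Finset.disjoint_left.1 h s.2 (hst ▸ t.2)) _ _

theorem SupportedOn.conj_permOp {S T : Finset Y} {M : Op Y q} (hM : SupportedOn S M)
    (σ : Equiv.Perm Y) (h : ∀ y ∈ S, σ y ∈ T) :
    SupportedOn T (permOp σ * M * permOp σ⁻¹) := by
  obtain ⟨m, rfl⟩ := hM
  refine ⟨embedOp (fun s : S => ⟨σ s.1, h s.1 s.2⟩) m, ?_⟩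
  rw [permOp_mul_embedOp σ Subtype.val_injective, mul_assoc, ← permOp_mul, mul_inv_cancel,
    permOp_one, mul_one, embedOp_comp Subtype.val_injective]
  rfl

/-! ### Two copies of a system -/

/-- Exchange of the two copies of each site of `B`. -/
def dswap (B : Finset X) : Equiv.Perm (X ⊕ X) :=
  Function.Involutive.toPerm
    (Sum.elim (fun x => if x ∈ B then Sum.inr x else Sum.inl x)
      (fun x => if x ∈ B then Sum.inl x else Sum.inr x))
    (by rintro (x | x) <;> by_cases h : x ∈ B <;> simp [h])

theorem dswap_inl (B : Finset X) (x : X) :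
    dswap B (Sum.inl x) = if x ∈ B then Sum.inr x else Sum.inl x := rfl

theorem dswap_inr (B : Finset X) (x : X) :
    dswap B (Sum.inr x) = if x ∈ B then Sum.inl x else Sum.inr x := rfl

theorem dswap_mul_self (B : Finset X) : dswap B * dswap B = 1 := by
  ext1 x
  rcases x with x | x <;> by_cases h : x ∈ B <;> simp [dswap_inl, dswap_inr, h]

theorem dswap_inv (B : Finset X) : (dswap B)⁻¹ = dswap B :=
  inv_eq_of_mul_eq_one_left (dswap_mul_self B)

theorem dswap_union {B B' : Finset X} (h : Disjoint B B') :
    dswap (B ∪ B') = dswap B * dswap B' := by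
  ext1 x
  rcases x with x | x <;> by_cases h1 : x ∈ B <;> by_cases h2 : x ∈ B' <;>
    first
    | exact absurd h2 (Finset.disjoint_left.1 h h1)
    | simp [dswap_inl, dswap_inr, h1, h2]

/-- The exchange operator of the two copies of the sites of `B`. -/
def swapOp (q : ℕ) (B : Finset X) : Op (X ⊕ X) q := permOp (dswap B)

theorem swapOp_mul_self (B : Finset X) : swapOp q B * swapOp q B = 1 := by
  rw [swapOp, ← permOp_mul, dswap_mul_self, permOp_one]

theorem swapOp_conjTranspose (B : Finset X) : (swapOp q B)ᴴ = swapOp q B := by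
  rw [swapOp, permOp_conjTranspose, dswap_inv]

theorem swapOp_union {B B' : Finset X} (h : Disjoint B B') :
    swapOp q (B ∪ B') = swapOp q B * swapOp q B' := by
  rw [swapOp, dswap_union h, permOp_mul]; rfl

theorem swapOp_eq_embedOp {B N : Finset X} (h : B ⊆ N) :
    swapOp q B = embedOp (Sum.map Subtype.val Subtype.val : N ⊕ N → X ⊕ X)
      (swapOp q (B.subtype (· ∈ N))) := by
  refine (embedOp_permOp (Subtype.val_injective.sumMap Subtype.val_injective) ?_ ?_).symm
  · rintro (⟨x, hx⟩ | ⟨x, hx⟩) <;> by_cases hB : x ∈ B <;> simp [dswap_inl, dswap_inr, hB]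
  · rintro (x | x) hx
    · rw [dswap_inl, if_neg fun hB => hx ⟨Sum.inl ⟨x, h hB⟩, rfl⟩]
    · rw [dswap_inr, if_neg fun hB => hx ⟨Sum.inr ⟨x, h hB⟩, rfl⟩]

/-- The same operator on both copies. -/
noncomputable def dbl (M : Op X q) : Op (X ⊕ X) q := embedOp Sum.inl M * embedOp Sum.inr M

theorem commute_inl_inr (M N : Op X q) :
    Commute (embedOp (Sum.inl : X → X ⊕ X) M) (embedOp Sum.inr N) :=
  embedOp_commute Sum.inl_injective Sum.inr_injective (by simp) _ _

theorem dbl_one : dbl (1 : Op X q) = 1 := by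
  rw [dbl, embedOp_one Sum.inl_injective, embedOp_one Sum.inr_injective, one_mul]

theorem dbl_mul (M N : Op X q) : dbl (M * N) = dbl M * dbl N := by
  rw [dbl, dbl, dbl, embedOp_mul Sum.inl_injective, embedOp_mul Sum.inr_injective, mul_assoc,
    mul_assoc, ← mul_assoc (embedOp Sum.inl N), (commute_inl_inr N M).eq, mul_assoc]

theorem dbl_conjTranspose (M : Op X q) : dbl Mᴴ = (dbl M)ᴴ := by
  rw [dbl, dbl, conjTranspose_mul, embedOp_conjTranspose, embedOp_conjTranspose,
    ← embedOp_conjTranspose, ← embedOp_conjTranspose, (commute_inl_inr _ _).eq]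

/-- The operator acts only on the two copies of the sites of `S`. -/
def DSupportedOn (S : Finset X) (M : Op (X ⊕ X) q) : Prop :=
  ∃ m : Op (S ⊕ S) q, embedOp (Sum.map Subtype.val Subtype.val : S ⊕ S → X ⊕ X) m = M

theorem sumMap_val_injective (S : Finset X) :
    (Sum.map Subtype.val Subtype.val : S ⊕ S → X ⊕ X).Injective :=
  Subtype.val_injective.sumMap Subtype.val_injective

theorem embedOp_dbl {S : Type} [Fintype S] [DecidableEq S] {g : S ⊕ S → Y}
    (hg : g.Injective) (M : Op S q) :
    embedOp g (dbl M) = embedOp (g ∘ Sum.inl) M * embedOp (g ∘ Sum.inr) M := by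
  rw [dbl, embedOp_mul hg, embedOp_comp hg, embedOp_comp hg]

theorem dbl_embedOp {S : Type} [Fintype S] [DecidableEq S] {f : S → X} (hf : f.Injective)
    (M : Op S q) : dbl (embedOp f M) = embedOp (Sum.map f f) (dbl M) := by
  rw [dbl, dbl, embedOp_mul (hf.sumMap hf), embedOp_comp Sum.inl_injective,
    embedOp_comp Sum.inr_injective, embedOp_comp (hf.sumMap hf), embedOp_comp (hf.sumMap hf)]
  rfl

theorem SupportedOn.dbl {S : Finset X} {M : Op X q} (h : SupportedOn S M) :
    DSupportedOn S (dbl M) := by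
  obtain ⟨m, rfl⟩ := h
  exact ⟨_, (dbl_embedOp Subtype.val_injective m).symm⟩

theorem DSupportedOn.swapOp {B S : Finset X} (h : B ⊆ S) : DSupportedOn S (swapOp q B) :=
  ⟨_, (swapOp_eq_embedOp h).symm⟩

theorem DSupportedOn.mul {S : Finset X} {M N : Op (X ⊕ X) q} (hM : DSupportedOn S M)
    (hN : DSupportedOn S N) : DSupportedOn S (M * N) := by
  obtain ⟨m, rfl⟩ := hM
  obtain ⟨n, rfl⟩ := hN
  exact ⟨m * n, embedOp_mul (sumMap_val_injective S) _ _⟩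

theorem DSupportedOn.conjTranspose {S : Finset X} {M : Op (X ⊕ X) q} (hM : DSupportedOn S M) :
    DSupportedOn S Mᴴ := by
  obtain ⟨m, rfl⟩ := hM
  exact ⟨mᴴ, embedOp_conjTranspose _ _⟩

theorem DSupportedOn.commute {S T : Finset X} {M N : Op (X ⊕ X) q} (hM : DSupportedOn S M)
    (hN : DSupportedOn T N) (h : Disjoint S T) : Commute M N := by
  obtain ⟨m, rfl⟩ := hM
  obtain ⟨n, rfl⟩ := hN
  refine embedOp_commute (sumMap_val_injective S) (sumMap_val_injective T) ?_ _ _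
  rintro (s | s) (t | t) <;> simp only [Sum.map_inl, Sum.map_inr, ne_eq, reduceCtorEq,
    not_false_eq_true, Sum.inl.injEq, Sum.inr.injEq]
  all_goals exact fun hst => Finset.disjoint_left.1 h s.2 (hst ▸ t.2)

/-- The exchange turns `M ⊗ M` into itself with the two factors interchanged, and these factors
commute. This is why gates in the interior of an exchanged arc disappear. -/
theorem commute_dbl_swapOp_of_subset {S B : Finset X} {M : Op X q} (hM : SupportedOn S M)
    (h : S ⊆ B) : Commute (SpinLattice.dbl M) (SpinLattice.swapOp q B) := by
  obtain ⟨m, rfl⟩ := hM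
  have hi : (Sum.inl ∘ Subtype.val : S → X ⊕ X).Injective :=
    Sum.inl_injective.comp Subtype.val_injective
  have hj : (Sum.inr ∘ Subtype.val : S → X ⊕ X).Injective :=
    Sum.inr_injective.comp Subtype.val_injective
  have h1 : (dswap B : X ⊕ X → X ⊕ X) ∘ (Sum.inl ∘ Subtype.val : S → X ⊕ X) =
      Sum.inr ∘ Subtype.val := by
    funext s; simp [dswap_inl, h s.2]
  have h2 : (dswap B : X ⊕ X → X ⊕ X) ∘ (Sum.inr ∘ Subtype.val : S → X ⊕ X) =
      Sum.inl ∘ Subtype.val := by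
    funext s; simp [dswap_inr, h s.2]
  refine Commute.symm ?_
  rw [SpinLattice.dbl, SpinLattice.swapOp, Commute, SemiconjBy,
    embedOp_comp Sum.inl_injective, embedOp_comp Sum.inr_injective, ← mul_assoc,
    permOp_mul_embedOp _ hi, mul_assoc, permOp_mul_embedOp _ hj, h1, h2, ← mul_assoc,
    (embedOp_commute hj hi (by simp) m m).eq]

end Support

/-! ### Expectation values, product states and the swap test -/

section Expectation

set_option linter.unusedSectionVars false

open scoped ComplexOrder

variable {S R X Y : Type} [Fintype S] [DecidableEq S] [Fintype R] [DecidableEq R]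
  [Fintype X] [DecidableEq X] [Fintype Y] [DecidableEq Y] {q : ℕ}

/-- The expectation value `⟨ψ|M|ψ⟩`. -/
def expect (ψ : StateVec Y q) (M : Op Y q) : ℂ := star ψ ⬝ᵥ (M *ᵥ ψ)

theorem expect_add (ψ : StateVec Y q) (M N : Op Y q) :
    expect ψ (M + N) = expect ψ M + expect ψ N := by
  simp [expect, add_mulVec, dotProduct_add]

theorem expect_smul (ψ : StateVec Y q) (z : ℂ) (M : Op Y q) :
    expect ψ (z • M) = z * expect ψ M := by
  simp [expect, smul_mulVec, dotProduct_smul]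

theorem expect_conj (ψ : StateVec Y q) (U M : Op Y q) :
    expect ψ (Uᴴ * M * U) = expect (U *ᵥ ψ) M := by
  simp only [expect, star_mulVec, ← mulVec_mulVec, dotProduct_mulVec, vecMul_vecMul]

theorem expect_smul_state (z : ℂ) (ψ : StateVec Y q) (M : Op Y q) :
    expect (z • ψ) M = (star z * z) * expect ψ M := by
  simp only [expect, star_smul, mulVec_smul, smul_dotProduct, dotProduct_smul, smul_eq_mul]
  ring

theorem norm_expect_le_one {ψ : StateVec Y q} (hψ : star ψ ⬝ᵥ ψ = 1) {M : Op Y q}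
    (hM : Mᴴ * M = 1) : ‖expect ψ M‖ ≤ 1 := by
  have h1 : star (M *ᵥ ψ) ⬝ᵥ (M *ᵥ ψ) = 1 := by
    rw [star_mulVec, ← dotProduct_mulVec, mulVec_mulVec, hM, one_mulVec, hψ]
  have h2 : star (M *ᵥ ψ) ⬝ᵥ ψ = star (expect ψ M) := star_dotProduct _ _
  -- The component of `M ψ` orthogonal to `ψ` has squared norm `1 - |⟨M⟩|²`.
  have h0 : (0 : ℂ) ≤ star (M *ᵥ ψ - expect ψ M • ψ) ⬝ᵥ (M *ᵥ ψ - expect ψ M • ψ) :=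
    dotProduct_star_self_nonneg _
  have h3 : star (M *ᵥ ψ - expect ψ M • ψ) ⬝ᵥ (M *ᵥ ψ - expect ψ M • ψ) =
      ((1 - ‖expect ψ M‖ ^ 2 : ℝ) : ℂ) := by
    have h4 : star ψ ⬝ᵥ (M *ᵥ ψ) = expect ψ M := rfl
    have h5 : star (expect ψ M) * expect ψ M = ((‖expect ψ M‖ ^ 2 : ℝ) : ℂ) := by
      rw [Complex.star_def, Complex.conj_mul']; push_cast; rfl
    rw [star_sub, star_smul, sub_dotProduct, dotProduct_sub, dotProduct_sub, smul_dotProduct,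
      smul_dotProduct, dotProduct_smul, dotProduct_smul, h1, h2, h4, hψ]
    simp only [smul_eq_mul, mul_one]
    rw [mul_comm (expect ψ M), h5]
    push_cast; ring
  rw [h3, Complex.zero_le_real] at h0
  nlinarith [norm_nonneg (expect ψ M)]

/-- The equality case of Cauchy–Schwarz: `‖Mψ - ψ‖² = 2 - 2 Re⟨M⟩ = 0`. -/
theorem mulVec_eq_self_of_expect_eq_one {ψ : StateVec Y q} (hψ : star ψ ⬝ᵥ ψ = 1) {M : Op Y q}
    (hM : Mᴴ * M = 1) (h : expect ψ M = 1) : M *ᵥ ψ = ψ := by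
  have h1 : star (M *ᵥ ψ) ⬝ᵥ (M *ᵥ ψ) = 1 := by
    rw [star_mulVec, ← dotProduct_mulVec, mulVec_mulVec, hM, one_mulVec, hψ]
  have h2 : star (M *ᵥ ψ) ⬝ᵥ ψ = star (expect ψ M) := star_dotProduct _ _
  have h3 : star ψ ⬝ᵥ (M *ᵥ ψ) = 1 := h
  rw [h, star_one] at h2
  refine sub_eq_zero.1 (dotProduct_star_self_eq_zero.1 ?_)
  rw [star_sub, sub_dotProduct, dotProduct_sub, dotProduct_sub, h1, h2, h3, hψ]
  simp

theorem expect_of_mulVec_eq_self {ψ : StateVec Y q} (hψ : star ψ ⬝ᵥ ψ = 1) {M : Op Y q}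
    (h : M *ᵥ ψ = ψ) : expect ψ M = 1 := by rw [expect, h, hψ]

/-! ### The product state -/

theorem expect_zeroState [NeZero q] (M : Op Y q) :
    expect (zeroState Y q) M = M (fun _ => 0) (fun _ => 0) := by
  simp [expect, zeroState]

/-- An intermediate configuration that contributes must vanish off `S`, because of `M`, and off `T`,
because of `N`; for disjoint `S` and `T` only the zero configuration is left. -/
theorem expect_zeroState_mul [NeZero q] {S T : Finset Y} {M N : Op Y q} (hM : SupportedOn S M)
    (hN : SupportedOn T N) (h : Disjoint S T) :
    expect (zeroState Y q) (M * N) = expect (zeroState Y q) M * expect (zeroState Y q) N := by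
  obtain ⟨m, rfl⟩ := hM
  obtain ⟨n, rfl⟩ := hN
  simp only [expect_zeroState, Matrix.mul_apply]
  rw [Finset.sum_eq_single (fun _ => 0)]
  · intro b _ hb
    by_contra hne
    obtain ⟨h1, h2⟩ := mul_ne_zero_iff.1 hne
    simp only [embedOp, of_apply, ne_eq, ite_eq_right_iff, not_forall] at h1 h2
    obtain ⟨h1, -⟩ := h1
    obtain ⟨h2, -⟩ := h2
    refine hb (funext fun y => ?_)
    by_cases hy : y ∈ S
    · exact h2 y (by simpa using Finset.disjoint_left.1 h hy)
    · exact (h1 y (by simpa using hy)).symm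
  · simp

/-! ### Two copies of a state -/

/-- The state `φ ⊗ χ` of two systems. -/
def prodState (φ : StateVec S q) (χ : StateVec R q) : StateVec (S ⊕ R) q :=
  fun a => φ (a ∘ Sum.inl) * χ (a ∘ Sum.inr)

theorem inl_mul_inr_mulVec (A : Op S q) (B : Op R q) (v : StateVec (S ⊕ R) q)
    (a : Config (S ⊕ R) q) :
    ((embedOp Sum.inl A * embedOp Sum.inr B) *ᵥ v) a =
      ∑ s, ∑ r, A (a ∘ Sum.inl) s * (B (a ∘ Sum.inr) r * v (Sum.elim s r)) := by
  rw [← mulVec_mulVec, embedOp_mulVec Sum.inl_injective]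
  refine Finset.sum_congr rfl fun s _ => ?_
  rw [embedOp_mulVec Sum.inr_injective, Finset.mul_sum]
  refine Finset.sum_congr rfl fun r _ => ?_
  have h1 : Function.extend Sum.inl s a ∘ Sum.inr = a ∘ Sum.inr := by
    funext r
    exact Function.extend_apply' _ _ _ (by simp)
  have h2 : Function.extend Sum.inr r (Function.extend Sum.inl s a) = Sum.elim s r := by
    funext y
    rcases y with y | y
    · rw [Function.extend_apply' _ _ _ (by simp), Sum.inl_injective.extend_apply]; rfl
    · rw [Sum.inr_injective.extend_apply]; rfl
  rw [h1, h2]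

theorem inl_mul_inr_mulVec_prodState (A : Op S q) (B : Op R q) (φ : StateVec S q)
    (χ : StateVec R q) :
    (embedOp Sum.inl A * embedOp Sum.inr B) *ᵥ prodState φ χ = prodState (A *ᵥ φ) (B *ᵥ χ) := by
  funext a
  rw [inl_mul_inr_mulVec]
  simp only [prodState, mulVec, dotProduct, Sum.elim_comp_inl, Sum.elim_comp_inr,
    Finset.sum_mul_sum]
  refine Finset.sum_congr rfl fun s _ => Finset.sum_congr rfl fun r _ => ?_
  ring

theorem star_prodState_dotProduct (φ φ' : StateVec S q) (χ χ' : StateVec R q) :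
    star (prodState φ χ) ⬝ᵥ prodState φ' χ' = (star φ ⬝ᵥ φ') * (star χ ⬝ᵥ χ') := by
  simp only [dotProduct, Finset.sum_mul_sum, ← Fintype.sum_prod_type']
  refine Fintype.sum_equiv (Equiv.sumArrowEquivProdArrow S R (Fin q)) _ _ fun a => ?_
  simp [prodState, Equiv.sumArrowEquivProdArrow]
  simp only [Function.comp_def]
  ring

theorem expect_inl_mul_inr (A : Op S q) (B : Op R q) (φ : StateVec S q) (χ : StateVec R q) :
    expect (prodState φ χ) (embedOp Sum.inl A * embedOp Sum.inr B) = expect φ A * expect χ B := by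
  rw [expect, inl_mul_inr_mulVec_prodState, star_prodState_dotProduct]; rfl

theorem dbl_mulVec_prodState (M : Op X q) (φ χ : StateVec X q) :
    dbl M *ᵥ prodState φ χ = prodState (M *ᵥ φ) (M *ᵥ χ) :=
  inl_mul_inr_mulVec_prodState M M φ χ

/-- Operators on two systems are sums of products. -/
theorem op_sum_induction {p : Op (S ⊕ R) q → Prop} (hadd : ∀ M N, p M → p N → p (M + N))
    (hsmul : ∀ (z : ℂ) M, p M → p (z • M))
    (hprod : ∀ A B, p (embedOp Sum.inl A * embedOp Sum.inr B)) (M : Op (S ⊕ R) q) : p M := by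
  refine Matrix.induction_on' M ?_ hadd fun i j x => ?_
  · simpa using hsmul 0 _ (hprod 1 1)
  · have : single i j x = x • (embedOp Sum.inl (single (i ∘ Sum.inl) (j ∘ Sum.inl) (1 : ℂ)) *
        embedOp Sum.inr (single (i ∘ Sum.inr) (j ∘ Sum.inr) (1 : ℂ)) : Op (S ⊕ R) q) := by
      refine op_ext fun v => funext fun a => ?_
      rw [smul_mulVec, Pi.smul_apply, inl_mul_inr_mulVec]
      simp only [single_apply, mulVec, dotProduct]
      by_cases h : i = a
      · subst h
        have : (Sum.elim (j ∘ Sum.inl) (j ∘ Sum.inr) : Config (S ⊕ R) q) = j := by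
          funext y; rcases y with y | y <;> rfl
        simp [this]
      · have : ¬ (i ∘ Sum.inl = a ∘ Sum.inl ∧ i ∘ Sum.inr = a ∘ Sum.inr) := by
          rintro ⟨h1, h2⟩
          exact h (funext fun y => by
            rcases y with y | y
            · exact congrFun h1 y
            · exact congrFun h2 y)
        by_cases h1 : i ∘ Sum.inl = a ∘ Sum.inl
        · have h2 : i ∘ Sum.inr ≠ a ∘ Sum.inr := fun h2 => this ⟨h1, h2⟩
          simp [h, h2]
        · simp [h, h1]
    rw [this]
    exact hsmul _ _ (hprod _ _)

/-- The swap test: exchanging part of two copies of a state has nonnegative expectation, the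
purity of that part. -/
theorem expect_swapOp_nonneg (B : Finset X) (φ : StateVec X q) :
    0 ≤ expect (prodState φ φ) (swapOp q B) := by
  classical
  let e := Equiv.piEquivPiSubtypeProd (fun x => x ∈ B) (fun _ => Fin q)
  -- Here `s` and `t` are the labels on `B` and off `B`. The inner sums over `t` are entries of the
  -- reduced density matrix of `B`, and the whole is its squared Hilbert–Schmidt norm.
  have key : expect (prodState φ φ) (swapOp q B) =
      ∑ s, ∑ s', (∑ t, star (φ (e.symm (s, t))) * φ (e.symm (s', t))) *
        star (∑ t, star (φ (e.symm (s, t))) * φ (e.symm (s', t))) := by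
    have h1 : expect (prodState φ φ) (swapOp q B) = ∑ a : Config X q, ∑ b : Config X q,
        (star (φ a) * star (φ b)) *
          (φ (fun x => if x ∈ B then b x else a x) * φ (fun x => if x ∈ B then a x else b x)) := by
      rw [expect, dotProduct, ← Fintype.sum_prod_type']
      refine Fintype.sum_equiv (Equiv.sumArrowEquivProdArrow X X (Fin q)) _ _ fun a => ?_
      rw [swapOp, permOp_mulVec]
      simp only [prodState, Pi.star_apply, star_mul', Equiv.sumArrowEquivProdArrow,
        Equiv.coe_fn_mk]
      congr 3
      · funext x; by_cases hx : x ∈ B <;> simp [dswap_inl, hx]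
      · funext x; by_cases hx : x ∈ B <;> simp [dswap_inr, hx]
    have h2 : ∀ s t s' t', (fun x => if x ∈ B then e.symm (s', t') x else e.symm (s, t) x) =
        e.symm (s', t) := by
      intro s t s' t'
      funext x
      by_cases hx : x ∈ B <;> simp [e, Equiv.piEquivPiSubtypeProd, hx]
    rw [h1, ← e.symm.sum_comp]
    simp_rw [← e.symm.sum_comp (fun b => (_ : ℂ) * _), Fintype.sum_prod_type, h2]
    refine Finset.sum_congr rfl fun s _ => ?_
    rw [Finset.sum_comm]
    refine Finset.sum_congr rfl fun s' _ => ?_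
    rw [star_sum, Finset.sum_mul_sum]
    refine Finset.sum_congr rfl fun t _ => Finset.sum_congr rfl fun t' _ => ?_
    rw [star_mul', star_star]
    ring
  rw [key]
  exact Finset.sum_nonneg fun s _ => Finset.sum_nonneg fun s' _ => mul_star_self_nonneg _

theorem expect_dbl_swapOp_nonneg (B : Finset X) (W : Op X q) (φ : StateVec X q) :
    0 ≤ expect (prodState φ φ) ((dbl W)ᴴ * swapOp q B * dbl W) := by
  rw [expect_conj, dbl_mulVec_prodState]
  exact expect_swapOp_nonneg _ _

theorem swapOp_mulVec_zeroState [NeZero q] (B : Finset X) :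
    swapOp q B *ᵥ prodState (zeroState X q) (zeroState X q) =
      prodState (zeroState X q) (zeroState X q) := by
  have h : ∀ a : Config (X ⊕ X) q, prodState (zeroState X q) (zeroState X q) a =
      if ∀ y, a y = 0 then 1 else 0 := by
    intro a
    simp only [prodState, zeroState, Pi.single_apply, funext_iff, Sum.forall, Function.comp]
    by_cases h1 : ∀ x, a (Sum.inl x) = 0 <;> simp [h1]
  funext a
  rw [swapOp, permOp_mulVec, h, h]
  refine if_congr ?_ rfl rfl
  exact ⟨fun H y => by simpa using H ((dswap B).symm y), fun H y => H _⟩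

end Expectation

/-! ### Arcs of a ring and narrow sets -/

section Arcs

set_option linter.unusedSectionVars false

variable {X : Type} [Fintype X] [DecidableEq X] {n : ℕ} {q : ℕ}

open Classical in
/-- The sites whose coordinate along the ring `ZMod n` lies in the integer interval `[u, v)`. -/
noncomputable def arc (p : X → ZMod n) (u v : ℤ) : Finset X :=
  Finset.univ.filter fun x => ∃ t : ℤ, u ≤ t ∧ t < v ∧ p x = t

variable {p : X → ZMod n}

theorem mem_arc {u v : ℤ} {x : X} : x ∈ arc p u v ↔ ∃ t : ℤ, u ≤ t ∧ t < v ∧ p x = t := by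
  simp [arc]

theorem arc_mono {u v u' v' : ℤ} (hu : u' ≤ u) (hv : v ≤ v') : arc p u v ⊆ arc p u' v' := by
  intro x hx
  obtain ⟨t, h1, h2, h3⟩ := mem_arc.1 hx
  exact mem_arc.2 ⟨t, by omega, by omega, h3⟩

theorem int_eq_of_cast_eq {s t : ℤ} (h : (s : ZMod n) = t) (h1 : s - t < n) (h2 : t - s < n) :
    s = t := by
  rw [ZMod.intCast_eq_intCast_iff_dvd_sub] at h
  have := Int.eq_zero_of_abs_lt_dvd h (by rw [abs_lt]; omega)
  omega

theorem arc_disjoint {u v u' v' : ℤ} (h : v ≤ u') (h' : v' ≤ u + n) :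
    Disjoint (arc p u v) (arc p u' v') := by
  rw [Finset.disjoint_left]
  intro x hx hx'
  obtain ⟨t, h1, h2, h3⟩ := mem_arc.1 hx
  obtain ⟨t', h1', h2', h3'⟩ := mem_arc.1 hx'
  have := int_eq_of_cast_eq (n := n) (h3.symm.trans h3') (by omega) (by omega)
  omega

theorem arc_union {u v w : ℤ} (h1 : u ≤ v) (h2 : v ≤ w) : arc p u v ∪ arc p v w = arc p u w := by
  ext x
  simp only [Finset.mem_union, mem_arc]
  constructor
  · rintro (⟨t, h⟩ | ⟨t, h⟩) <;> exact ⟨t, by omega, by omega, h.2.2⟩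
  · rintro ⟨t, h, h', h3⟩
    rcases lt_or_ge t v with hv | hv
    · exact Or.inl ⟨t, h, hv, h3⟩
    · exact Or.inr ⟨t, hv, h', h3⟩

/-- Any two sites of `S` have coordinates at distance at most `r`. -/
def IsNarrow (p : X → ZMod n) (r : ℕ) (S : Finset X) : Prop :=
  ∀ x ∈ S, ∀ y ∈ S, ∃ e : ℤ, -r ≤ e ∧ e ≤ r ∧ p x = p y + e

theorem IsNarrow.subset_arc {r : ℕ} {S : Finset X} (hS : IsNarrow p r S) {u v : ℤ}
    (h : ¬ Disjoint S (arc p u v)) : S ⊆ arc p (u - r) (v + r) := by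
  obtain ⟨x, hx, hxa⟩ := Finset.not_disjoint_iff.1 h
  obtain ⟨t, h1, h2, h3⟩ := mem_arc.1 hxa
  intro y hy
  obtain ⟨e, h4, h5, h6⟩ := hS y hy x hx
  exact mem_arc.2 ⟨t + e, by omega, by omega, by rw [h6, h3]; push_cast; rfl⟩

/-- A narrow set that meets both an arc and its complement is near one of the two ends. -/
theorem IsNarrow.subset_arc_end {r : ℕ} {S : Finset X} (hS : IsNarrow p r S) (hr : 3 * r < n)
    {u v : ℤ} (h : ¬ Disjoint S (arc p u v)) (h' : ¬ S ⊆ arc p u v) :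
    S ⊆ arc p (u - r) (u + r) ∨ S ⊆ arc p (v - r) (v + r) := by
  obtain ⟨x, hx, hxa⟩ := Finset.not_disjoint_iff.1 h
  obtain ⟨y, hy, hya⟩ := Finset.not_subset.1 h'
  obtain ⟨t, h1, h2, h3⟩ := mem_arc.1 hxa
  obtain ⟨e, he1, he2, he3⟩ := hS y hy x hx
  have hout : t + e < u ∨ v ≤ t + e := by
    by_contra hc
    push Not at hc
    exact hya (mem_arc.2 ⟨t + e, hc.1, hc.2, by rw [he3, h3]; push_cast; rfl⟩)
  -- The offsets of `z` from `x` and from `y` are consistent modulo `n`. The discrepancy is at most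
  -- `3 * r < n`, so they are consistent as integers, and `S` can be treated as a subset of the
  -- line.
  have hz : ∀ z ∈ S, ∃ e₁ e₂ : ℤ, -r ≤ e₁ ∧ e₁ ≤ r ∧ -r ≤ e₂ ∧ e₂ ≤ r ∧ e₁ = e + e₂ ∧
      p z = ((t + e₁ : ℤ) : ZMod n) := by
    intro z hz
    obtain ⟨e₁, h4, h5, h6⟩ := hS z hz x hx
    obtain ⟨e₂, h7, h8, h9⟩ := hS z hz y hy
    refine ⟨e₁, e₂, h4, h5, h7, h8, ?_, by rw [h6, h3]; push_cast; rfl⟩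
    refine int_eq_of_cast_eq (n := n) ?_ (by omega) (by omega)
    have := h6.symm.trans h9
    rw [he3, add_assoc] at this
    push_cast
    exact add_left_cancel this
  rcases hout with hout | hout
  · left
    intro z hzS
    obtain ⟨e₁, e₂, h4, h5, h6, h7, h8, h9⟩ := hz z hzS
    exact mem_arc.2 ⟨t + e₁, by omega, by omega, h9⟩
  · right
    intro z hzS
    obtain ⟨e₁, e₂, h4, h5, h6, h7, h8, h9⟩ := hz z hzS
    exact mem_arc.2 ⟨t + e₁, by omega, by omega, h9⟩

end Arcs

/-! ### Locality of circuits along the ring -/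

section Locality

set_option linter.unusedSectionVars false

variable {X : Type} [Fintype X] [DecidableEq X] {n : ℕ} {q : ℕ} {p : X → ZMod n}

/-- Circuits of at most `D` layers of commuting unitaries with supports of width at most `r`. -/
def IsCircuit (p : X → ZMod n) (r D : ℕ) (U : unitaryGroup (Config X q) ℂ) : Prop :=
  ∃ c : List (List (unitaryGroup (Config X q) ℂ)), c.length ≤ D ∧
    (∀ l ∈ c, l.Pairwise Commute) ∧
    (∀ l ∈ c, ∀ g ∈ l, ∃ S, SupportedOn S (g : Op X q) ∧ IsNarrow p r S) ∧ layeredProd c = U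

theorem IsCircuit.inv {r D : ℕ} {U : unitaryGroup (Config X q) ℂ} (h : IsCircuit p r D U) :
    IsCircuit p r D U⁻¹ := by
  obtain ⟨c, h1, h2, h3, rfl⟩ := h
  refine ⟨_, ?_, ?_, ?_, (layeredProd_inv c).symm⟩
  · simpa using h1
  · intro l hl
    simp only [List.mem_map, List.mem_reverse] at hl
    obtain ⟨l, hl, rfl⟩ := hl
    rw [List.pairwise_reverse, List.pairwise_map]
    exact (h2 l hl).imp fun hab => hab.symm.inv_inv
  · intro l hl g hg
    simp only [List.mem_map, List.mem_reverse] at hl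
    obtain ⟨l, hl, rfl⟩ := hl
    rw [List.mem_reverse, List.mem_map] at hg
    obtain ⟨g, hg, rfl⟩ := hg
    obtain ⟨S, hS, hS'⟩ := h3 l hl g hg
    exact ⟨S, hS.conjTranspose, hS'⟩

theorem IsCircuit.mul {r D D' : ℕ} {U U' : unitaryGroup (Config X q) ℂ}
    (h : IsCircuit p r D U) (h' : IsCircuit p r D' U') : IsCircuit p r (D + D') (U' * U) := by
  obtain ⟨c, h1, h2, h3, rfl⟩ := h
  obtain ⟨c', h1', h2', h3', rfl⟩ := h'
  refine ⟨c ++ c', by simp; omega, ?_, ?_, layeredProd_append c c'⟩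
  · intro l hl
    rcases List.mem_append.1 hl with hl | hl
    exacts [h2 l hl, h2' l hl]
  · intro l hl
    rcases List.mem_append.1 hl with hl | hl
    exacts [h3 l hl, h3' l hl]

theorem mul_le_mul_cast {r k D : ℕ} (h : k ≤ D) : (r : ℤ) * k ≤ r * D := by
  exact_mod_cast Nat.mul_le_mul_left r h

/-- Each layer enlarges the light cone by `r` on both sides: a gate disjoint from the current arc
cancels, and one that meets it reaches at most `r` beyond. -/
theorem IsCircuit.supportedOn_conj {r D : ℕ} {U : unitaryGroup (Config X q) ℂ}
    (h : IsCircuit p r D U) {u v : ℤ} {M : Op X q} (hM : SupportedOn (arc p u v) M) :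
    SupportedOn (arc p (u - r * D) (v + r * D)) ((U : Op X q)ᴴ * M * (U : Op X q)) := by
  obtain ⟨c, h1, h2, h3, rfl⟩ := h
  let gen : ℕ → Set (unitaryGroup (Config X q) ℂ) := fun k =>
    {w | SupportedOn (arc p (u - r * k) (v + r * k)) (w : Op X q)}
  have hmono : Monotone gen := fun k k' hk w hw => by
    have := mul_le_mul_cast (r := r) hk
    exact SupportedOn.mono hw (arc_mono (by omega) (by omega))
  obtain ⟨C, hC, hCM⟩ := exists_lightCone (unitaryGroup (Config X q) ℂ).subtype M gen hmono D c
    h1 h2 (fun l hl g hg k _ => by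
      obtain ⟨S, hS, hS'⟩ := h3 l hl g hg
      have hk : (0 : ℤ) ≤ r * k := by positivity
      by_cases hd : Disjoint S (arc p (u - r * k) (v + r * k))
      · right
        exact ⟨hS.commute hM (hd.mono_right (arc_mono (by omega) (by omega))),
          fun w hw => Subtype.ext (hS.commute hw hd)⟩
      · left
        refine hS.mono ((hS'.subset_arc hd).trans (arc_mono ?_ ?_)) <;> push_cast <;> linarith)
  have hC' : SupportedOn (arc p (u - r * D) (v + r * D)) (C : Op X q) := by
    have := Submonoid.closure_mono (hmono h1) hC
    clear hC hCM
    induction this using Submonoid.closure_induction with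
    | mem w hw => exact hw
    | one => exact SupportedOn.one _
    | mul x y _ _ hx hy => exact hx.mul hy
  have hD : (0 : ℤ) ≤ r * D := by positivity
  have hM' : SupportedOn (arc p (u - r * D) (v + r * D)) M :=
    hM.mono (arc_mono (by omega) (by omega))
  have e : ((layeredProd c : unitaryGroup (Config X q) ℂ) : Op X q)ᴴ * M * (layeredProd c : unitaryGroup (Config X q) ℂ) =
      (C : Op X q)ᴴ * M * (C : Op X q) := hCM
  rw [e]
  exact (hC'.conjTranspose.mul hM').mul hC'

/-- In a state prepared by a circuit, operators on far apart arcs are uncorrelated. -/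
theorem IsCircuit.expect_mul [NeZero q] {r D : ℕ} {U : unitaryGroup (Config X q) ℂ}
    (h : IsCircuit p r D U) {ψ : StateVec X q} (hψ : (U : Op X q) *ᵥ ψ = zeroState X q)
    {u v u' v' : ℤ} {M N : Op X q} (hM : SupportedOn (arc p u v) M)
    (hN : SupportedOn (arc p u' v') N) (h1 : v + 2 * (r * D) ≤ u')
    (h2 : v' + 2 * (r * D) ≤ u + n) :
    expect ψ (M * N) = expect ψ M * expect ψ N := by
  have hU : (U : Op X q)ᴴ * (U : Op X q) = 1 := Unitary.coe_star_mul_self U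
  -- The correlation is moved to the product state. This conjugates by the inverse circuit, which
  -- has the same depth and range.
  have key : ∀ M : Op X q, expect ψ M = expect (zeroState X q) (U * M * (U : Op X q)ᴴ) := by
    intro M
    rw [← hψ, ← expect_conj]
    congr 1
    calc M = ((U : Op X q)ᴴ * (U : Op X q)) * M * ((U : Op X q)ᴴ * (U : Op X q)) := by rw [hU, one_mul, mul_one]
      _ = _ := by simp only [mul_assoc]
  have hM' := h.inv.supportedOn_conj hM
  have hN' := h.inv.supportedOn_conj hN
  have e : ((U⁻¹ : unitaryGroup (Config X q) ℂ) : Op X q) = (U : Op X q)ᴴ := rfl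
  rw [e, conjTranspose_conjTranspose] at hM' hN'
  rw [key, key M, key N,
    ← expect_zeroState_mul hM' hN' (arc_disjoint (by linarith) (by linarith))]
  congr 1
  calc (U : Op X q) * (M * N) * (U : Op X q)ᴴ
      = U * M * 1 * N * (U : Op X q)ᴴ := by simp only [mul_one, mul_assoc]
    _ = _ := by rw [← hU]; simp only [mul_assoc]

/-- Both sides are bilinear, so each operator may be taken to be a product over the two copies, and
the one-copy statement applies to each copy separately. -/
theorem IsCircuit.expect_dbl_mul [NeZero q] {r D : ℕ} {U : unitaryGroup (Config X q) ℂ}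
    (h : IsCircuit p r D U) {ψ : StateVec X q} (hψ : (U : Op X q) *ᵥ ψ = zeroState X q)
    {u v u' v' : ℤ} {M N : Op (X ⊕ X) q} (hM : DSupportedOn (arc p u v) M)
    (hN : DSupportedOn (arc p u' v') N) (h1 : v + 2 * (r * D) ≤ u')
    (h2 : v' + 2 * (r * D) ≤ u + n) :
    expect (prodState ψ ψ) (M * N) = expect (prodState ψ ψ) M * expect (prodState ψ ψ) N := by
  obtain ⟨m, rfl⟩ := hM
  obtain ⟨m', rfl⟩ := hN
  have hsplit : ∀ (S : Finset X) (A B : Op S q),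
      embedOp (Sum.map Subtype.val Subtype.val : S ⊕ S → X ⊕ X)
        (embedOp Sum.inl A * embedOp Sum.inr B) =
      embedOp Sum.inl (embedOp (Subtype.val : S → X) A) *
        embedOp Sum.inr (embedOp (Subtype.val : S → X) B) := by
    intro S A B
    rw [embedOp_mul (sumMap_val_injective S), embedOp_comp (sumMap_val_injective S),
      embedOp_comp (sumMap_val_injective S), embedOp_comp Sum.inl_injective,
      embedOp_comp Sum.inr_injective]
    rfl
  induction m using op_sum_induction with
  | hadd A B hA hB => rw [embedOp_add, add_mul, expect_add, expect_add, hA, hB, add_mul]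
  | hsmul z A hA => rw [embedOp_smul, smul_mul_assoc, expect_smul, expect_smul, hA, mul_assoc]
  | hprod A B =>
    induction m' using op_sum_induction with
    | hadd A B hA hB => rw [embedOp_add, mul_add, expect_add, expect_add, hA, hB, mul_add]
    | hsmul z A hA =>
      rw [embedOp_smul, mul_smul_comm, expect_smul, expect_smul, hA, mul_left_comm]
    | hprod A' B' =>
      rw [hsplit, hsplit, expect_inl_mul_inr, expect_inl_mul_inr, mul_assoc,
        ← mul_assoc (embedOp Sum.inr _), ← (commute_inl_inr _ _).eq, mul_assoc,
        ← embedOp_mul Sum.inr_injective, ← mul_assoc, ← embedOp_mul Sum.inl_injective,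
        expect_inl_mul_inr, h.expect_mul hψ ⟨A, rfl⟩ ⟨A', rfl⟩ h1 h2,
        h.expect_mul hψ ⟨B, rfl⟩ ⟨B', rfl⟩ h1 h2]
      ring

/-- Conjugating the exchange of an arc by a circuit only involves the ends of the arc. -/
theorem IsCircuit.exists_swapOp_conj {r D : ℕ} {U : unitaryGroup (Config X q) ℂ}
    (h : IsCircuit p r D U) {a : ℤ} (ha : 4 * (r * D) < a) (ha' : a + 4 * (r * D) < n) :
    ∃ C C' : unitaryGroup (Config X q) ℂ,
      SupportedOn (arc p (-(r * D)) (r * D)) (C : Op X q) ∧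
      SupportedOn (arc p (a - r * D) (a + r * D)) (C' : Op X q) ∧
      (dbl (U : Op X q))ᴴ * swapOp q (arc p 0 a) * dbl (U : Op X q) =
        (dbl ((C : Op X q) * (C' : Op X q)))ᴴ * swapOp q (arc p 0 a) * dbl ((C : Op X q) * (C' : Op X q)) := by
  obtain ⟨c, h1, h2, h3, rfl⟩ := h
  -- Two windows grow around the ends `0` and `a`. A gate outside both windows can cross an end only
  -- if it lies in the next window; otherwise it is inside or outside the exchanged arc and commutes
  -- with the exchange.
  let gen : ℕ → Set (unitaryGroup (Config X q) ℂ) := fun k =>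
    {w | SupportedOn (arc p (-(r * k)) (r * k)) (w : Op X q) ∨
      SupportedOn (arc p (a - r * k) (a + r * k)) (w : Op X q)}
  have hmono : Monotone gen := fun k k' hk w hw => by
    have := mul_le_mul_cast (r := r) hk
    exact hw.imp (fun hw => hw.mono (arc_mono (by omega) (by omega)))
      (fun hw => hw.mono (arc_mono (by omega) (by omega)))
  let φ : unitaryGroup (Config X q) ℂ →* Op (X ⊕ X) q :=
    { toFun := fun u => dbl (u : Op X q)
      map_one' := dbl_one
      map_mul' := fun u v => dbl_mul _ _ }
  obtain ⟨C, hC, hCM⟩ := exists_lightCone φ (swapOp q (arc p 0 a)) gen hmono D c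
    h1 h2 (fun l hl g hg k hkD => by
      obtain ⟨S, hS, hS'⟩ := h3 l hl g hg
      have hk : (0 : ℤ) ≤ r * k := by positivity
      have hk' : (r : ℤ) * k + r ≤ r * D := by
        have := mul_le_mul_cast (r := r) (Nat.succ_le_of_lt hkD)
        push_cast at this; linarith
      by_cases hd : Disjoint S (arc p (-(r * k)) (r * k))
      · by_cases hd' : Disjoint S (arc p (a - r * k) (a + r * k))
        · by_cases hc : ¬ Disjoint S (arc p 0 a) ∧ ¬ S ⊆ arc p 0 a
          · left
            refine (hS'.subset_arc_end (by omega) hc.1 hc.2).imp (fun hs => hS.mono (hs.trans ?_))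
              (fun hs => hS.mono (hs.trans ?_)) <;>
            refine arc_mono ?_ ?_ <;> push_cast <;> linarith
          · right
            refine ⟨?_, fun w hw => hw.elim (fun hw => Subtype.ext (hS.commute hw hd))
              (fun hw => Subtype.ext (hS.commute hw hd'))⟩
            by_cases hc' : Disjoint S (arc p 0 a)
            · exact hS.dbl.commute (DSupportedOn.swapOp subset_rfl) hc'
            · exact commute_dbl_swapOp_of_subset hS (by tauto)
        · left; right
          refine hS.mono ((hS'.subset_arc hd').trans (arc_mono ?_ ?_)) <;> push_cast <;> linarith
      · left; left
        refine hS.mono ((hS'.subset_arc hd).trans (arc_mono ?_ ?_)) <;> push_cast <;> linarith)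
  -- The two windows are disjoint, so a word in their unitaries can be sorted into one factor for
  -- each end.
  have hC' : ∃ C₀ C₁ : unitaryGroup (Config X q) ℂ,
      SupportedOn (arc p (-(r * D)) (r * D)) (C₀ : Op X q) ∧
      SupportedOn (arc p (a - r * D) (a + r * D)) (C₁ : Op X q) ∧ C = C₀ * C₁ := by
    have := Submonoid.closure_mono (hmono h1) hC
    clear hC hCM
    induction this using Submonoid.closure_induction with
    | mem w hw =>
      rcases hw with hw | hw
      · exact ⟨w, 1, hw, SupportedOn.one _, by simp⟩
      · exact ⟨1, w, SupportedOn.one _, hw, by simp⟩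
    | one => exact ⟨1, 1, SupportedOn.one _, SupportedOn.one _, by simp⟩
    | mul x y _ _ hx hy =>
      obtain ⟨x₀, x₁, hx₀, hx₁, rfl⟩ := hx
      obtain ⟨y₀, y₁, hy₀, hy₁, rfl⟩ := hy
      have hD : (0 : ℤ) ≤ r * D := by positivity
      have : Commute x₁ y₀ := Subtype.ext
        (hx₁.commute hy₀ (arc_disjoint (by linarith) (by linarith)).symm)
      exact ⟨x₀ * y₀, x₁ * y₁, hx₀.mul hy₀, hx₁.mul hy₁, by
        rw [mul_assoc, ← mul_assoc x₁, this.eq]; simp only [mul_assoc]⟩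
  obtain ⟨C₀, C₁, hC₀, hC₁, rfl⟩ := hC'
  refine ⟨C₀, C₁, hC₀, hC₁, ?_⟩
  rw [← dbl_conjTranspose, ← dbl_conjTranspose]
  exact hCM

end Locality

/-! ### Translation eigenvectors and translated operators -/

section Translation

set_option linter.unusedSectionVars false

variable {X : Type} [Fintype X] [DecidableEq X] {n : ℕ} {q : ℕ} {p : X → ZMod n}

theorem permOp_pow_mulVec {σ : Equiv.Perm X} {ψ : StateVec X q} {z : ℂ}
    (h : permOp σ *ᵥ ψ = z • ψ) (k : ℕ) : permOp (σ ^ k) *ᵥ ψ = z ^ k • ψ := by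
  induction k with
  | zero => simp [permOp_one]
  | succ k ih => rw [pow_succ, permOp_mul, ← mulVec_mulVec, h, mulVec_smul, ih, smul_smul, pow_succ']

theorem permOp_inv_mulVec {σ : Equiv.Perm X} {ψ : StateVec X q} {z : ℂ} (hz : z ≠ 0)
    (h : permOp σ *ᵥ ψ = z • ψ) : permOp σ⁻¹ *ᵥ ψ = z⁻¹ • ψ := by
  have h1 : permOp σ⁻¹ *ᵥ (permOp σ *ᵥ ψ) = ψ := by
    rw [mulVec_mulVec, ← permOp_mul, inv_mul_cancel, permOp_one, one_mulVec]
  rw [h, mulVec_smul] at h1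
  rw [← h1, smul_smul, inv_mul_cancel₀ hz, one_smul, h1]

theorem expect_permOp_conj {σ : Equiv.Perm X} {ψ : StateVec X q} {z : ℂ} (hz : z ≠ 0)
    (hψ : star ψ ⬝ᵥ ψ = 1) (h : permOp σ *ᵥ ψ = z • ψ) (M : Op X q) :
    expect ψ (permOp σ * M * permOp σ⁻¹) = expect ψ M := by
  have key : ∀ M : Op X q,
      expect ψ (permOp σ * M * permOp σ⁻¹) = (star z⁻¹ * z⁻¹) * expect ψ M := by
    intro M
    have e : (permOp σ : Op X q) = (permOp σ⁻¹)ᴴ := by rw [permOp_conjTranspose, inv_inv]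
    rw [e, expect_conj, permOp_inv_mulVec hz h, expect_smul_state]
  -- That `z` has modulus 1 is not assumed; taking `M = 1` shows that the prefactor is 1.
  have h1 := key 1
  rw [mul_one, ← permOp_mul, mul_inv_cancel, permOp_one,
    expect_of_mulVec_eq_self hψ (one_mulVec ψ), mul_one] at h1
  rw [key, ← h1, one_mul]

theorem permOp_conjTranspose_mul_self (σ : Equiv.Perm X) :
    (permOp σ : Op X q)ᴴ * permOp σ = 1 := by
  rw [permOp_conjTranspose, ← permOp_mul, inv_mul_cancel, permOp_one]

theorem permOp_mul_conjTranspose_self (σ : Equiv.Perm X) :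
    (permOp σ : Op X q) * (permOp σ)ᴴ = 1 := by
  rw [permOp_conjTranspose, ← permOp_mul, mul_inv_cancel, permOp_one]

theorem commute_permOp_embedOp {S : Type} [Fintype S] [DecidableEq S] {f : S → X}
    (hf : f.Injective) {e : Equiv.Perm X} (he : ∀ s, e (f s) = f s) (A : Op S q) :
    Commute (permOp e) (embedOp f A) := by
  rw [Commute, SemiconjBy, permOp_mul_embedOp e hf]
  congr 2
  exact funext he

theorem dbl_permOp (σ : Equiv.Perm X) :
    dbl (permOp σ : Op X q) = permOp (Equiv.sumCongr σ σ) := by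
  refine op_ext fun v => funext fun a => ?_
  rw [dbl, inl_mul_inr_mulVec, permOp_mulVec]
  have : a ∘ (Equiv.sumCongr σ σ) = Sum.elim ((a ∘ Sum.inl) ∘ σ) ((a ∘ Sum.inr) ∘ σ) := by
    funext y; rcases y with y | y <;> rfl
  simp [permOp, this]

theorem dbl_permOp_mul_swapOp (σ : Equiv.Perm X) {B B' : Finset X} (h : ∀ x, σ x ∈ B' ↔ x ∈ B) :
    dbl (permOp σ) * swapOp q B = swapOp q B' * dbl (permOp σ) := by
  rw [dbl_permOp, swapOp, swapOp, ← permOp_mul, ← permOp_mul]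
  congr 1
  ext1 x
  rcases x with x | x <;> by_cases hx : x ∈ B <;> simp [dswap_inl, dswap_inr, h, hx]

theorem apply_pow_coord {σ : Equiv.Perm X} (hp : ∀ x, p (σ x) = p x + 1) (k : ℕ) (x : X) :
    p ((σ ^ k) x) = p x + k := by
  induction k with
  | zero => simp
  | succ k ih => rw [pow_succ', Equiv.Perm.mul_apply, hp, ih]; push_cast; ring

theorem pow_apply_mem_arc {σ : Equiv.Perm X} (hp : ∀ x, p (σ x) = p x + 1) (k : ℕ) {u v : ℤ}
    {x : X} : (σ ^ k) x ∈ arc p (u + k) (v + k) ↔ x ∈ arc p u v := by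
  simp only [mem_arc, apply_pow_coord hp]
  constructor
  · rintro ⟨t, h1, h2, h3⟩
    refine ⟨t - k, by omega, by omega, ?_⟩
    push_cast; rw [← h3]; ring
  · rintro ⟨t, h1, h2, h3⟩
    refine ⟨t + k, by omega, by omega, ?_⟩
    push_cast; rw [← h3]

theorem apply_mem_arc {σ : Equiv.Perm X} (hp : ∀ x, p (σ x) = p x + 1) {u v : ℤ} {x : X} :
    σ x ∈ arc p (u + 1) (v + 1) ↔ x ∈ arc p u v := by
  simpa using pow_apply_mem_arc hp 1 (u := u) (v := v) (x := x)

end Translation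

/-! ### Moving one end of a dressed exchange -/

section Exchange

set_option linter.unusedSectionVars false

variable {X : Type} [Fintype X] [DecidableEq X] {n : ℕ} {q : ℕ} {p : X → ZMod n}

/-- The exchange of the two copies of `B`, conjugated by the same unitary on both copies. -/
noncomputable def dressedSwap (C : Op X q) (B : Finset X) : Op (X ⊕ X) q :=
  (dbl C)ᴴ * swapOp q B * dbl C

theorem dressedSwap_conjTranspose (C : Op X q) (B : Finset X) :
    (dressedSwap C B)ᴴ = dressedSwap C B := by
  simp only [dressedSwap, conjTranspose_mul, conjTranspose_conjTranspose, swapOp_conjTranspose,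
    mul_assoc]

theorem conj_mul_conj {V : Op X q} (hV : Vᴴ * V = 1) (A B : Op X q) :
    Vᴴ * A * V * (Vᴴ * B * V) = Vᴴ * (A * B) * V := by
  calc Vᴴ * A * V * (Vᴴ * B * V) = Vᴴ * A * (V * Vᴴ) * B * V := by simp only [mul_assoc]
    _ = Vᴴ * (A * B) * V := by rw [mul_eq_one_comm.1 hV, mul_one]; simp only [mul_assoc]

theorem conj_conjTranspose_mul_self {V A : Op X q} (hV : Vᴴ * V = 1) (hA : Aᴴ * A = 1) :
    (Vᴴ * A * V)ᴴ * (Vᴴ * A * V) = 1 := by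
  rw [conjTranspose_mul, conjTranspose_mul, conjTranspose_conjTranspose, ← mul_assoc Vᴴ,
    conj_mul_conj hV, hA, mul_one, hV]

theorem permOp_conj_conjTranspose_mul_self (σ : Equiv.Perm X) {A : Op X q} (hA : Aᴴ * A = 1) :
    (permOp σ * A * (permOp σ)ᴴ)ᴴ * (permOp σ * A * (permOp σ)ᴴ) = 1 := by
  have h : ((permOp σ : Op X q)ᴴ)ᴴ * (permOp σ)ᴴ = 1 := by
    rw [conjTranspose_conjTranspose, permOp_mul_conjTranspose_self]
  simpa only [conjTranspose_conjTranspose] using conj_conjTranspose_mul_self h hA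

theorem dbl_mul_dbl_conjTranspose {C : Op X q} (hC : C * Cᴴ = 1) : dbl C * (dbl C)ᴴ = 1 := by
  rw [← dbl_conjTranspose, ← dbl_mul, hC, dbl_one]

theorem dbl_conjTranspose_mul_dbl {C : Op X q} (hC : Cᴴ * C = 1) : (dbl C)ᴴ * dbl C = 1 := by
  rw [← dbl_conjTranspose, ← dbl_mul, hC, dbl_one]

theorem dressedSwap_mul_self {C : Op X q} (hC : Cᴴ * C = 1) (B : Finset X) :
    dressedSwap C B * dressedSwap C B = 1 := by
  have h1 := dbl_mul_dbl_conjTranspose (mul_eq_one_comm.1 hC)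
  have h2 := dbl_conjTranspose_mul_dbl hC
  calc dressedSwap C B * dressedSwap C B
      = (dbl C)ᴴ * swapOp q B * (dbl C * (dbl C)ᴴ) * swapOp q B * dbl C := by
        simp only [dressedSwap, mul_assoc]
    _ = (dbl C)ᴴ * (swapOp q B * swapOp q B) * dbl C := by
        rw [h1, mul_one]; simp only [mul_assoc]
    _ = 1 := by rw [swapOp_mul_self, mul_one, h2]

theorem DSupportedOn.dressedSwap {S B : Finset X} {C : Op X q} (hC : SupportedOn S C)
    (hB : B ⊆ S) : DSupportedOn S (dressedSwap C B) :=
  (hC.dbl.conjTranspose.mul (DSupportedOn.swapOp hB)).mul hC.dbl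

/-- Separates an exchange dressed at both ends into left end, bare middle and right end, so that the
two ends can be moved independently. -/
theorem dressedSwap_mul {S S' B B' M : Finset X} {C C' : Op X q} (hC : SupportedOn S C)
    (hC' : SupportedOn S' C') (hB : B ⊆ S) (hB' : B' ⊆ S') (hSS' : Disjoint S S')
    (hSM : Disjoint S M) (hSM' : Disjoint S' M) :
    dressedSwap (C * C') (B ∪ (M ∪ B')) =
      dressedSwap C B * (swapOp q M * dressedSwap C' B') := by
  have hM : DSupportedOn M (swapOp q M) := DSupportedOn.swapOp subset_rfl
  have c1 : Commute (dbl C) (swapOp q M) := hC.dbl.commute hM hSM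
  have c2 : Commute (dbl C) (swapOp q B') :=
    hC.dbl.commute (DSupportedOn.swapOp hB') hSS'
  have c3 : Commute (dbl C')ᴴ (dressedSwap C B) :=
    hC'.dbl.conjTranspose.commute (DSupportedOn.dressedSwap hC hB) hSS'.symm
  have c4 : Commute (dbl C')ᴴ (swapOp q M) := hC'.dbl.conjTranspose.commute hM hSM'
  rw [dressedSwap, swapOp_union, swapOp_union (hSM'.symm.mono_right hB'), dbl_mul,
    conjTranspose_mul]
  · calc (dbl C')ᴴ * (dbl C)ᴴ * (swapOp q B * (swapOp q M * swapOp q B')) * (dbl C * dbl C')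
        = (dbl C')ᴴ * ((dbl C)ᴴ * swapOp q B) * ((swapOp q M * swapOp q B') * dbl C) * dbl C' := by
          simp only [mul_assoc]
      _ = (dbl C')ᴴ * dressedSwap C B * swapOp q M * swapOp q B' * dbl C' := by
          rw [← (c1.mul_right c2).eq]; simp only [dressedSwap, mul_assoc]
      _ = dressedSwap C B * ((dbl C')ᴴ * swapOp q M) * swapOp q B' * dbl C' := by
          rw [c3.eq]; simp only [mul_assoc]
      _ = dressedSwap C B * (swapOp q M * dressedSwap C' B') := by
          rw [c4.eq]; simp only [dressedSwap, mul_assoc]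
  · exact Finset.disjoint_union_right.2 ⟨hSM.mono_left hB, hSS'.mono hB hB'⟩

theorem dbl_permOp_mul_dressedSwap (σ : Equiv.Perm X) (C : Op X q) {B B' : Finset X}
    (h : ∀ x, σ x ∈ B' ↔ x ∈ B) :
    dressedSwap (permOp σ * C * (permOp σ)ᴴ) B' =
      dbl (permOp σ) * dressedSwap C B * (dbl (permOp σ))ᴴ := by
  have h1 : (dbl (permOp σ : Op X q))ᴴ * dbl (permOp σ) = 1 :=
    dbl_conjTranspose_mul_dbl (permOp_conjTranspose_mul_self σ)
  have h2 : (dbl (permOp σ : Op X q))ᴴ * swapOp q B' * dbl (permOp σ) = swapOp q B := by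
    rw [mul_assoc, ← dbl_permOp_mul_swapOp σ h, ← mul_assoc, h1, one_mul]
  rw [dressedSwap, dbl_mul, dbl_mul, dbl_conjTranspose, conjTranspose_mul, conjTranspose_mul,
    conjTranspose_conjTranspose, dressedSwap, ← h2]
  simp only [mul_assoc]

theorem eq_one_of_mul_eq_one {x y : ℂ} (hx : 0 ≤ x.re ∧ x.im = 0) (hx1 : ‖x‖ ≤ 1) (hy1 : ‖y‖ ≤ 1)
    (h : x * y = 1) : x = 1 := by
  have h1 : ‖x‖ * ‖y‖ = 1 := by rw [← norm_mul, h, norm_one]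
  have h2 : ‖x‖ = 1 := by nlinarith [norm_nonneg x, norm_nonneg y]
  have h3 : x = (x.re : ℂ) := Complex.ext rfl (by simp [hx.2])
  rw [h3, Complex.norm_real, Real.norm_of_nonneg hx.1] at h2
  rw [h3, h2, Complex.ofReal_one]

/-- For a translation-invariant state prepared by a circuit, the exchange of two copies on a half
line can be dressed at its end so that moving the end does not change its action. -/
theorem IsCircuit.exists_dressedSwap [NeZero q] {r D : ℕ} {U : unitaryGroup (Config X q) ℂ}
    (h : IsCircuit p r D U) {ψ : StateVec X q} (hψ : (U : Op X q) *ᵥ ψ = zeroState X q)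
    (hψ1 : star ψ ⬝ᵥ ψ = 1) {σ : Equiv.Perm X} (hp : ∀ x, p (σ x) = p x + 1) {z : ℂ}
    (hz : z ≠ 0) (hσ : permOp σ *ᵥ ψ = z • ψ)
    {a : ℤ} (ha : 4 * (r * D) < a) (ha' : a + 4 * (r * D) < n) :
    ∃ C : unitaryGroup (Config X q) ℂ, SupportedOn (arc p (-(r * D)) (r * D)) (C : Op X q) ∧
      expect (prodState ψ ψ)
        (dressedSwap (permOp σ * (C : Op X q) * (permOp σ)ᴴ) (arc p 1 (r * D + 1)) *
          dressedSwap (C : Op X q) (arc p 0 (r * D + 1))) = 1 := by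
  obtain ⟨C, C', hC, hC', hS⟩ := h.exists_swapOp_conj ha ha'
  refine ⟨C, hC, ?_⟩
  have hρ : (0 : ℤ) ≤ r * D := by positivity
  set ρ : ℤ := r * D with hρdef
  set T : Op X q := permOp σ with hT
  have hTT : Tᴴ * T = 1 := permOp_conjTranspose_mul_self σ
  have hU1 : (C : Op X q)ᴴ * (C : Op X q) = 1 := Unitary.coe_star_mul_self C
  have hU2 : (C' : Op X q)ᴴ * (C' : Op X q) = 1 := Unitary.coe_star_mul_self C'
  set C₁ : Op X q := T * (C : Op X q) * Tᴴ with hC₁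
  set C₁' : Op X q := T * (C' : Op X q) * Tᴴ with hC₁'
  -- The arcs are one cell longer than the support of the dressing, to accommodate the translated
  -- dressing as well. The hypotheses on `a` give exactly the gap of `2 * ρ` between these longer
  -- arcs that the factorization of expectation values requires.
  have s0 : SupportedOn (arc p (-ρ) (ρ + 1)) (C : Op X q) :=
    hC.mono (arc_mono le_rfl (by omega))
  have s0' : SupportedOn (arc p (a - ρ) (a + ρ + 1)) (C' : Op X q) :=
    hC'.mono (arc_mono le_rfl (by omega))
  have s1 : SupportedOn (arc p (-ρ) (ρ + 1)) C₁ := by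
    rw [hC₁, hT, permOp_conjTranspose]
    exact hC.conj_permOp σ fun y hy =>
      arc_mono (by omega) le_rfl ((apply_mem_arc hp).2 hy)
  have s1' : SupportedOn (arc p (a - ρ) (a + ρ + 1)) C₁' := by
    rw [hC₁', hT, permOp_conjTranspose]
    exact hC'.conj_permOp σ fun y hy =>
      arc_mono (by omega) le_rfl ((apply_mem_arc hp).2 hy)
  have hNN : Disjoint (arc p (-ρ) (ρ + 1)) (arc p (a - ρ) (a + ρ + 1)) :=
    arc_disjoint (by omega) (by omega)
  have hNM : Disjoint (arc p (-ρ) (ρ + 1)) (arc p (ρ + 1) (a - ρ)) :=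
    arc_disjoint (by omega) (by omega)
  have hNM' : Disjoint (arc p (a - ρ) (a + ρ + 1)) (arc p (ρ + 1) (a - ρ)) :=
    (arc_disjoint (by omega) (by omega)).symm
  have hB0 : arc p 0 (ρ + 1) ⊆ arc p (-ρ) (ρ + 1) := arc_mono (by omega) le_rfl
  have hB1 : arc p 1 (ρ + 1) ⊆ arc p (-ρ) (ρ + 1) := arc_mono (by omega) le_rfl
  have hB0' : arc p (a - ρ) a ⊆ arc p (a - ρ) (a + ρ + 1) := arc_mono le_rfl (by omega)
  have hB1' : arc p (a - ρ) (a + 1) ⊆ arc p (a - ρ) (a + ρ + 1) :=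
    arc_mono le_rfl (by omega)
  have d0 := DSupportedOn.dressedSwap s0 hB0
  have d1 := DSupportedOn.dressedSwap s1 hB1
  have d0' := DSupportedOn.dressedSwap s0' hB0'
  have d1' := DSupportedOn.dressedSwap s1' hB1'
  have dM : DSupportedOn (arc p (ρ + 1) (a - ρ)) (swapOp q (arc p (ρ + 1) (a - ρ))) :=
    DSupportedOn.swapOp subset_rfl
  have f0 := dressedSwap_mul s0 s0' hB0 hB0' hNN hNM hNM'
  have f1 := dressedSwap_mul s1 s1' hB1 hB1' hNN hNM hNM'
  -- A hybrid, with the left end moved and the right end in place: it is itself a conjugated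
  -- exchange, so its expectation value is nonnegative.
  have f10 := dressedSwap_mul s1 s0' hB1 hB0' hNN hNM hNM'
  rw [arc_union (by omega) (by omega), arc_union (by omega) (by omega)] at f0 f1
  set X₀ := dressedSwap (C : Op X q) (arc p 0 (ρ + 1)) with hX₀
  set X₁ := dressedSwap C₁ (arc p 1 (ρ + 1)) with hX₁
  set Y₀ := dressedSwap (C' : Op X q) (arc p (a - ρ) a) with hY₀
  set Y₁ := dressedSwap C₁' (arc p (a - ρ) (a + 1)) with hY₁
  set M := swapOp q (arc p (ρ + 1) (a - ρ)) with hM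
  set Ψ := prodState ψ ψ with hΨ
  have hΨ1 : star Ψ ⬝ᵥ Ψ = 1 := by rw [hΨ, star_prodState_dotProduct, hψ1, one_mul]
  have iX₀ : X₀ * X₀ = 1 := dressedSwap_mul_self hU1 _
  have iX₁ : X₁ * X₁ = 1 := dressedSwap_mul_self (permOp_conj_conjTranspose_mul_self σ hU1) _
  have iY₀ : Y₀ * Y₀ = 1 := dressedSwap_mul_self hU2 _
  have iY₁ : Y₁ * Y₁ = 1 := dressedSwap_mul_self (permOp_conj_conjTranspose_mul_self σ hU2) _
  have iM : M * M = 1 := swapOp_mul_self _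
  -- the full exchanges fix `Ψ`
  have e0 : (X₀ * (M * Y₀)) *ᵥ Ψ = Ψ := by
    have hUU : (U : Op X q)ᴴ * (U : Op X q) = 1 := Unitary.coe_star_mul_self U
    rw [← f0, dressedSwap, ← hS, ← mulVec_mulVec, ← mulVec_mulVec, hΨ, dbl_mulVec_prodState, hψ,
      swapOp_mulVec_zeroState, ← hψ, ← dbl_mulVec_prodState, mulVec_mulVec,
      dbl_conjTranspose_mul_dbl hUU, one_mulVec]
  have hTΨ : dbl T *ᵥ Ψ = (z * z) • Ψ := by
    rw [hΨ, dbl_mulVec_prodState, hσ]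
    funext c
    simp only [prodState, Pi.smul_apply, smul_eq_mul, Function.comp_def]
    ring
  have hTΨ' : (dbl T)ᴴ *ᵥ Ψ = (z * z)⁻¹ • Ψ := by
    have h1 : (dbl T)ᴴ *ᵥ (dbl T *ᵥ Ψ) = Ψ := by
      rw [mulVec_mulVec, dbl_conjTranspose_mul_dbl hTT, one_mulVec]
    rw [hTΨ, mulVec_smul] at h1
    rw [← h1, smul_smul, inv_mul_cancel₀ (mul_ne_zero hz hz), one_smul, h1]
  have e1 : (X₁ * (M * Y₁)) *ᵥ Ψ = Ψ := by
    have hTCC : C₁ * C₁' = T * ((C : Op X q) * (C' : Op X q)) * Tᴴ := by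
      calc C₁ * C₁' = T * (C : Op X q) * (Tᴴ * T) * (C' : Op X q) * Tᴴ := by
            simp only [hC₁, hC₁', mul_assoc]
        _ = _ := by rw [hTT, mul_one]; simp only [mul_assoc]
    rw [← f1, hTCC, hT, dbl_permOp_mul_dressedSwap σ _ (B := arc p 0 a)
      (fun x => by simpa using apply_mem_arc hp (u := 0) (v := a) (x := x)), ← hT,
      ← mulVec_mulVec, ← mulVec_mulVec, hTΨ', mulVec_smul, f0, e0, mulVec_smul, hTΨ, smul_smul,
      inv_mul_cancel₀ (mul_ne_zero hz hz), one_smul]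
  have cXY : ∀ {A B : Op (X ⊕ X) q}, DSupportedOn (arc p (-ρ) (ρ + 1)) A →
      DSupportedOn (arc p (a - ρ) (a + ρ + 1)) B → Commute A B :=
    fun hA hB => hA.commute hB hNN
  have cXM : Commute X₀ M := d0.commute dM hNM
  have cYM : Commute Y₁ M := d1'.commute dM hNM'
  have e2 : (M * Y₀) *ᵥ Ψ = X₀ *ᵥ Ψ := by
    conv_rhs => rw [← e0]
    rw [mulVec_mulVec, ← mul_assoc, iX₀, one_mul]
  -- On `Ψ` the remainder `M * Y₀` acts as the involution `X₀`, so the hybrid exchange has the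
  -- expectation value of `X₁ * X₀`.
  have hpos : 0 ≤ (expect Ψ (X₁ * X₀)).re ∧ (expect Ψ (X₁ * X₀)).im = 0 := by
    have := expect_dbl_swapOp_nonneg (arc p 1 (ρ + 1) ∪ (arc p (ρ + 1) (a - ρ) ∪ arc p (a - ρ) a))
      (C₁ * (C' : Op X q)) ψ
    rw [← dressedSwap, f10] at this
    have e3 : expect Ψ (X₁ * (M * Y₀)) = expect Ψ (X₁ * X₀) := by
      rw [expect, ← mulVec_mulVec, e2, mulVec_mulVec]; rfl
    rw [← hΨ, e3, Complex.le_def] at this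
    exact ⟨this.1, this.2.symm⟩
  -- The middle exchange cancels in the product of the moved and the original exchange, leaving one
  -- operator at each end.
  have hprod : expect Ψ (X₁ * X₀) * expect Ψ (Y₁ * Y₀) = 1 := by
    rw [hΨ, ← h.expect_dbl_mul hψ (d1.mul d0) (d1'.mul d0') (by omega) (by omega), ← hΨ]
    refine expect_of_mulVec_eq_self hΨ1 ?_
    have e4 : X₁ * X₀ * (Y₁ * Y₀) = (X₁ * (M * Y₁)) * (X₀ * (M * Y₀)) := by
      calc X₁ * X₀ * (Y₁ * Y₀) = X₁ * (X₀ * Y₁) * Y₀ := by simp only [mul_assoc]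
        _ = X₁ * Y₁ * (M * M) * X₀ * Y₀ := by
            rw [(cXY d0 d1').eq, iM, mul_one]; simp only [mul_assoc]
        _ = X₁ * (Y₁ * M) * (M * X₀) * Y₀ := by simp only [mul_assoc]
        _ = _ := by rw [cYM.eq, ← cXM.eq]; simp only [mul_assoc]
    rw [e4, ← mulVec_mulVec, e0, e1]
  have hu : ∀ {A B : Op (X ⊕ X) q}, Aᴴ = A → Bᴴ = B → A * A = 1 → B * B = 1 →
      ‖expect Ψ (A * B)‖ ≤ 1 := by
    intro A B hA hB hAA hBB
    refine norm_expect_le_one hΨ1 ?_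
    rw [conjTranspose_mul, hA, hB, mul_assoc, ← mul_assoc A, hAA, one_mul, hBB]
  exact eq_one_of_mul_eq_one hpos
    (hu (dressedSwap_conjTranspose _ _) (dressedSwap_conjTranspose _ _) iX₁ iX₀)
    (hu (dressedSwap_conjTranspose _ _) (dressedSwap_conjTranspose _ _) iY₁ iY₀) hprod

end Exchange

/-! ### A translate as the second copy, and cutting the ring into two -/

section Reconnection

set_option linter.unusedSectionVars false

variable {X : Type} [Fintype X] [DecidableEq X] {n : ℕ} {q : ℕ} {p : X → ZMod n}

/-- Exchange of each site `x` of `B` with the site `τ x`, for `B` disjoint from its image. -/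
def pairSwap (τ : Equiv.Perm X) (B : Finset X) (h : ∀ x ∈ B, τ x ∉ B) : Equiv.Perm X :=
  Function.Involutive.toPerm
    (fun x => if x ∈ B then τ x else if τ.symm x ∈ B then τ.symm x else x) (by
      intro x
      by_cases h1 : x ∈ B
      · simp [h1, h x h1]
      · by_cases h2 : τ.symm x ∈ B <;> simp [h1, h2])

theorem pairSwap_apply (τ : Equiv.Perm X) (B : Finset X) (h : ∀ x ∈ B, τ x ∉ B) (x : X) :
    pairSwap τ B h x = if x ∈ B then τ x else if τ.symm x ∈ B then τ.symm x else x := rfl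

theorem pairSwap_mul_self (τ : Equiv.Perm X) (B : Finset X) (h : ∀ x ∈ B, τ x ∉ B) :
    pairSwap τ B h * pairSwap τ B h = 1 :=
  Equiv.ext fun x => Function.Involutive.toPerm_involutive _ x

/-- The sites of `N` and their images under `τ`. -/
def withImage (τ : Equiv.Perm X) (N : Finset X) : N ⊕ N → X :=
  Sum.elim Subtype.val (τ ∘ Subtype.val)

theorem withImage_injective {τ : Equiv.Perm X} {N : Finset X} (h : ∀ x ∈ N, τ x ∉ N) :
    (withImage τ N).Injective := by
  refine Function.Injective.sumElim Subtype.val_injective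
    (τ.injective.comp Subtype.val_injective) fun a b hab => h b b.2 ?_
  have hab' : a.1 = τ b.1 := hab
  exact hab' ▸ a.2

theorem embedOp_withImage_swapOp {τ : Equiv.Perm X} {B N : Finset X} (hBN : B ⊆ N)
    (h : ∀ x ∈ N, τ x ∉ N) :
    embedOp (withImage τ N) (swapOp q (B.subtype (· ∈ N))) =
      permOp (pairSwap τ B fun x hx hx' => h x (hBN hx) (hBN hx')) := by
  refine embedOp_permOp (withImage_injective h) ?_ ?_
  · rintro (⟨x, hx⟩ | ⟨x, hx⟩)
    · by_cases hB : x ∈ B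
      · simp [withImage, dswap_inl, pairSwap_apply, hB]
      · have : τ.symm x ∉ B := fun h' => h _ (hBN h') (by simpa using hx)
        simp [withImage, dswap_inl, pairSwap_apply, hB, this]
    · have : τ x ∉ B := fun h' => h x hx (hBN h')
      by_cases hB : x ∈ B <;> simp [withImage, dswap_inr, pairSwap_apply, hB, this]
  · intro y hy
    rw [pairSwap_apply, if_neg, if_neg]
    · exact fun hB => hy ⟨Sum.inr ⟨_, hBN hB⟩, by simp [withImage]⟩
    · exact fun hB => hy ⟨Sum.inl ⟨_, hBN hB⟩, rfl⟩

theorem pairSwap_conj {σ τ : Equiv.Perm X} (hc : ∀ x, τ (σ x) = σ (τ x)) {B B' : Finset X}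
    (hB : ∀ x ∈ B, τ x ∉ B) (hB' : ∀ x ∈ B', τ x ∉ B') (h : ∀ x, σ x ∈ B' ↔ x ∈ B) :
    pairSwap τ B' hB' * σ = σ * pairSwap τ B hB := by
  have hc' : ∀ x, τ.symm (σ x) = σ (τ.symm x) := fun x => by
    rw [Equiv.symm_apply_eq, hc, Equiv.apply_symm_apply]
  ext1 x
  rw [Equiv.Perm.mul_apply, Equiv.Perm.mul_apply, pairSwap_apply, pairSwap_apply, hc, hc']
  simp only [h]
  split_ifs <;> rfl

/-- In the state prepared by a circuit, a far translate of a region serves as a second copy. -/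
theorem IsCircuit.expect_withImage [NeZero q] {r D : ℕ} {U : unitaryGroup (Config X q) ℂ}
    (h : IsCircuit p r D U) {ψ : StateVec X q} (hψ : (U : Op X q) *ᵥ ψ = zeroState X q)
    (hψ1 : star ψ ⬝ᵥ ψ = 1) {τ : Equiv.Perm X} {z : ℂ} (hz : z ≠ 0)
    (hτ : permOp τ *ᵥ ψ = z • ψ) {u v a : ℤ}
    (hτp : ∀ x ∈ arc p u v, τ x ∈ arc p (u + a) (v + a))
    (h1 : v + 2 * (r * D) ≤ u + a) (h2 : v + a + 2 * (r * D) ≤ u + n)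
    (hd : ∀ x ∈ arc p u v, τ x ∉ arc p u v) (m : Op (arc p u v ⊕ arc p u v) q) :
    expect ψ (embedOp (withImage τ (arc p u v)) m) =
      expect (prodState ψ ψ)
        (embedOp (Sum.map Subtype.val Subtype.val : arc p u v ⊕ arc p u v → X ⊕ X) m) := by
  have hi := withImage_injective hd
  have hj := sumMap_val_injective (arc p u v)
  induction m using op_sum_induction with
  | hadd A B hA hB => rw [embedOp_add, embedOp_add, expect_add, expect_add, hA, hB]
  | hsmul z A hA => rw [embedOp_smul, embedOp_smul, expect_smul, expect_smul, hA]
  | hprod A B =>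
    have e1 : embedOp (Sum.map Subtype.val Subtype.val : arc p u v ⊕ arc p u v → X ⊕ X)
        (embedOp Sum.inl A * embedOp Sum.inr B) =
        embedOp Sum.inl (embedOp (Subtype.val : arc p u v → X) A) *
          embedOp Sum.inr (embedOp (Subtype.val : arc p u v → X) B) := by
      rw [embedOp_mul hj, embedOp_comp hj, embedOp_comp hj, embedOp_comp Sum.inl_injective,
        embedOp_comp Sum.inr_injective]
      rfl
    have e2 : embedOp (τ ∘ Subtype.val : arc p u v → X) B =
        permOp τ * embedOp (Subtype.val : arc p u v → X) B * permOp τ⁻¹ := by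
      rw [permOp_mul_embedOp τ Subtype.val_injective, mul_assoc, ← permOp_mul, mul_inv_cancel,
        permOp_one, mul_one]
    have e3 : embedOp (withImage τ (arc p u v)) (embedOp Sum.inl A * embedOp Sum.inr B) =
        embedOp (Subtype.val : arc p u v → X) A *
          (permOp τ * embedOp (Subtype.val : arc p u v → X) B * permOp τ⁻¹) := by
      rw [← e2, embedOp_mul hi, embedOp_comp hi, embedOp_comp hi]
      rfl
    rw [e1, e3, expect_inl_mul_inr, h.expect_mul hψ (u := u) (v := v) ⟨A, rfl⟩
      (SupportedOn.conj_permOp ⟨B, rfl⟩ τ hτp) h1 h2, expect_permOp_conj hz hψ1 hτ]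

/-- The permutation `π` follows `σ` for `m - 1` steps from `y` and then returns to `y`, so these
points lie on a closed orbit whose length divides `m`. -/
theorem pow_apply_orbit {π σ : Equiv.Perm X} {m : ℕ} (hm : 0 < m) {y : X}
    (h : ∀ k, k + 1 < m → π ((σ ^ k) y) = (σ ^ (k + 1)) y) (h' : π ((σ ^ (m - 1)) y) = y)
    (i : ℕ) (hi : i < m) : (π ^ m) ((σ ^ i) y) = (σ ^ i) y := by
  have h1 : ∀ k, k < m → (π ^ k) y = (σ ^ k) y := by
    intro k
    induction k with
    | zero => simp
    | succ k ih =>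
      intro hk
      rw [pow_succ', Equiv.Perm.mul_apply, ih (by omega), h k hk]
  have h2 : (π ^ m) y = y := by
    obtain ⟨m, rfl⟩ : ∃ k, m = k + 1 := ⟨m - 1, by omega⟩
    rw [pow_succ', Equiv.Perm.mul_apply, h1 m (by omega)]
    simpa using h'
  rw [← h1 i hi, ← Equiv.Perm.mul_apply, ← pow_add, add_comm, pow_add, Equiv.Perm.mul_apply, h2]

/-- Translating after exchanging two slabs at distance `a` splits the ring into rings of lengths
`a` and `b`. -/
theorem reconnect_pow_eq_one [NeZero n] {σ : Equiv.Perm X} (hp : ∀ x, p (σ x) = p x + 1)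
    (hσ : σ ^ n = 1) {a b : ℕ} (ha : 0 < a) (hb : 0 < b) (hab : a + b = n) (ρ : ℤ)
    (hB : ∀ x ∈ arc p ρ (ρ + 1), (σ ^ a) x ∉ arc p ρ (ρ + 1)) :
    (σ * pairSwap (σ ^ a) (arc p ρ (ρ + 1)) hB) ^ (a * b) = 1 := by
  set B := arc p ρ (ρ + 1) with hBdef
  set π := σ * pairSwap (σ ^ a) B hB with hπ
  have hBmem : ∀ x, x ∈ B ↔ p x = (ρ : ZMod n) := by
    intro x
    rw [hBdef, mem_arc]
    constructor
    · rintro ⟨t, h1, h2, h3⟩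
      obtain rfl : t = ρ := by omega
      exact h3
    · exact fun h => ⟨ρ, le_rfl, by omega, h⟩
  have hinv : ∀ x, p ((σ ^ a).symm x) = p x - a := by
    intro x
    have := apply_pow_coord hp a ((σ ^ a).symm x)
    rw [Equiv.apply_symm_apply] at this
    rw [this]; ring
  -- Away from the slabs at `ρ` and `ρ + a` this is the plain translation. At `ρ + a` the site jumps
  -- back and continues at `ρ + 1`, closing a ring of length `a`; at `ρ` it jumps ahead to `ρ + a +
  -- 1`, closing one of length `b`.
  have hplain : ∀ (x : X) (t : ℤ), p x = t → ρ < t → t < ρ + n → t ≠ ρ + a → π x = σ x := by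
    intro x t hx h1 h2 h3
    rw [hπ, Equiv.Perm.mul_apply, pairSwap_apply, if_neg, if_neg]
    · rw [hBmem, hinv, hx]
      intro h
      have : ((t - a : ℤ) : ZMod n) = ρ := by push_cast; exact h
      have := int_eq_of_cast_eq this (by omega) (by omega)
      omega
    · rw [hBmem, hx]
      intro h
      have := int_eq_of_cast_eq h (by omega) (by omega)
      omega
  have hn : ((n : ℕ) : ZMod n) = 0 := ZMod.natCast_self n
  have hfirst : ∀ y : X, p y = ((ρ + 1 : ℤ) : ZMod n) → ∀ i < a,
      (π ^ a) ((σ ^ i) y) = (σ ^ i) y := by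
    intro y hy
    refine pow_apply_orbit ha ?_ ?_
    · intro k hk
      rw [pow_succ', Equiv.Perm.mul_apply]
      refine hplain _ (ρ + 1 + k) ?_ (by omega) (by omega) (by omega)
      rw [apply_pow_coord hp, hy]; push_cast; ring
    · have h1 : p ((σ ^ (a - 1)) y) = ((ρ + a : ℤ) : ZMod n) := by
        rw [apply_pow_coord hp, hy]
        push_cast [Nat.cast_sub ha]; ring
      have h2 : (σ ^ (a - 1)) y ∉ B := by
        rw [hBmem, h1]
        intro h
        have := int_eq_of_cast_eq h (by omega) (by omega)
        omega
      have h3 : (σ ^ a).symm ((σ ^ (a - 1)) y) ∈ B := by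
        rw [hBmem, hinv, h1]; push_cast; ring
      rw [hπ, Equiv.Perm.mul_apply, pairSwap_apply, if_neg h2, if_pos h3]
      obtain ⟨k, rfl⟩ : ∃ k, a = k + 1 := ⟨a - 1, by omega⟩
      rw [Nat.add_sub_cancel, ← Equiv.eq_symm_apply, Equiv.symm_apply_eq, pow_succ,
        Equiv.Perm.mul_apply, Equiv.apply_symm_apply]
  have hsecond : ∀ y : X, p y = ((ρ + a + 1 : ℤ) : ZMod n) → ∀ i < b,
      (π ^ b) ((σ ^ i) y) = (σ ^ i) y := by
    intro y hy
    refine pow_apply_orbit hb ?_ ?_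
    · intro k hk
      rw [pow_succ', Equiv.Perm.mul_apply]
      refine hplain _ (ρ + a + 1 + k) ?_ (by omega) (by omega) (by omega)
      rw [apply_pow_coord hp, hy]; push_cast; ring
    · have h2 : (σ ^ (b - 1)) y ∈ B := by
        rw [hBmem, apply_pow_coord hp, hy]
        push_cast [Nat.cast_sub hb]
        have : ((a : ZMod n) + b) = 0 := by rw [← hn, ← hab]; push_cast; ring
        linear_combination this
      -- The second ring closes only because `σ ^ n = 1`: the jump by `a`, the final step and the `b
      -- - 1` earlier steps add up to one full turn.
      rw [hπ, Equiv.Perm.mul_apply, pairSwap_apply, if_pos h2, ← Equiv.Perm.mul_apply,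
        ← Equiv.Perm.mul_apply, ← pow_succ', ← pow_add, show a + 1 + (b - 1) = n by omega, hσ]
      rfl
  ext1 x
  obtain ⟨i, hi, hx⟩ : ∃ i < n, p x = ((ρ + 1 + i : ℤ) : ZMod n) := by
    refine ⟨(p x - (ρ + 1 : ℤ)).val, ZMod.val_lt _, ?_⟩
    push_cast
    rw [ZMod.natCast_zmod_val]
    ring
  rcases lt_or_ge i a with hia | hia
  · have hy : p ((σ ^ i).symm x) = ((ρ + 1 : ℤ) : ZMod n) := by
      have := apply_pow_coord hp i ((σ ^ i).symm x)
      rw [Equiv.apply_symm_apply, hx] at this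
      push_cast at this ⊢
      linear_combination -this
    have h1 : (π ^ a) x = x := by simpa using hfirst _ hy i hia
    rw [pow_mul]
    exact Equiv.Perm.pow_apply_eq_self_of_apply_eq_self h1 b
  · have hy : p ((σ ^ (i - a)).symm x) = ((ρ + a + 1 : ℤ) : ZMod n) := by
      have := apply_pow_coord hp (i - a) ((σ ^ (i - a)).symm x)
      rw [Equiv.apply_symm_apply, hx, Nat.cast_sub hia] at this
      push_cast at this ⊢
      linear_combination -this
    have h1 : (π ^ b) x = x := by simpa using hsecond _ hy (i - a) (by omega)
    rw [mul_comm, pow_mul]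
    exact Equiv.Perm.pow_apply_eq_self_of_apply_eq_self h1 a

end Reconnection

/-! ### The eigenvalue of a short-range entangled state -/

section Momentum

set_option linter.unusedSectionVars false

variable {X : Type} [Fintype X] [DecidableEq X] {n : ℕ} {q : ℕ} {p : X → ZMod n}

theorem embedOp_dressedSwap {B N : Finset X} (hB : B ⊆ N) (c : Op N q) :
    embedOp (Sum.map Subtype.val Subtype.val : N ⊕ N → X ⊕ X)
      (dressedSwap c (B.subtype (· ∈ N))) = dressedSwap (embedOp Subtype.val c) B := by
  rw [dressedSwap, embedOp_mul (sumMap_val_injective N), embedOp_mul (sumMap_val_injective N),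
    embedOp_conjTranspose, ← dbl_embedOp Subtype.val_injective, ← swapOp_eq_embedOp hB]
  rfl

/-- The product of an operator with its conjugate by the site permutation `τ`. -/
noncomputable def withTranslate (τ : Equiv.Perm X) (C : Op X q) : Op X q :=
  C * (permOp τ * C * permOp τ⁻¹)

theorem embedOp_withImage_dressedSwap {τ : Equiv.Perm X} {B N : Finset X} (hB : B ⊆ N)
    (h : ∀ x ∈ N, τ x ∉ N) (c : Op N q) :
    embedOp (withImage τ N) (dressedSwap c (B.subtype (· ∈ N))) =
      (withTranslate τ (embedOp Subtype.val c))ᴴ *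
        permOp (pairSwap τ B fun x hx hx' => h x (hB hx) (hB hx')) *
          withTranslate τ (embedOp Subtype.val c) := by
  have hi := withImage_injective h
  have e : embedOp (withImage τ N) (dbl c) = withTranslate τ (embedOp Subtype.val c) := by
    rw [embedOp_dbl hi, withTranslate, permOp_mul_embedOp τ Subtype.val_injective, mul_assoc,
      ← permOp_mul, mul_inv_cancel, permOp_one, mul_one]
    rfl
  rw [dressedSwap, embedOp_mul hi, embedOp_mul hi, embedOp_conjTranspose, e,
    embedOp_withImage_swapOp hB h]

theorem permOp_pairSwap_union {τ : Equiv.Perm X} {B B' N : Finset X} (hB : B ⊆ N) (hB' : B' ⊆ N)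
    (h : ∀ x ∈ N, τ x ∉ N) (hd : Disjoint B B') :
    (permOp (pairSwap τ (B ∪ B') fun x hx hx' =>
        h x (Finset.union_subset hB hB' hx) (Finset.union_subset hB hB' hx')) : Op X q) =
      permOp (pairSwap τ B fun x hx hx' => h x (hB hx) (hB hx')) *
        permOp (pairSwap τ B' fun x hx hx' => h x (hB' hx) (hB' hx')) := by
  rw [← embedOp_withImage_swapOp (Finset.union_subset hB hB') h, ← embedOp_withImage_swapOp hB h,
    ← embedOp_withImage_swapOp hB' h, ← embedOp_mul (withImage_injective h), ← swapOp_union]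
  · congr 2
    ext x; simp
  · rw [Finset.disjoint_left]
    intro x hx hx'
    exact Finset.disjoint_left.1 hd (Finset.mem_subtype.1 hx) (Finset.mem_subtype.1 hx')

theorem withTranslate_conjTranspose_mul_self {τ : Equiv.Perm X} {C : Op X q} (hC : Cᴴ * C = 1) :
    (withTranslate τ C)ᴴ * withTranslate τ C = 1 := by
  have h1 : (permOp τ⁻¹ : Op X q) * permOp τ = 1 := by
    rw [← permOp_mul, inv_mul_cancel, permOp_one]
  have h2 : (permOp τ : Op X q) * permOp τ⁻¹ = 1 := mul_eq_one_comm.1 h1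
  calc (withTranslate τ C)ᴴ * withTranslate τ C
      = permOp τ * Cᴴ * permOp τ⁻¹ * (Cᴴ * C) * permOp τ * C * permOp τ⁻¹ := by
        simp only [withTranslate, conjTranspose_mul, permOp_conjTranspose, inv_inv, mul_assoc]
    _ = permOp τ * Cᴴ * (permOp τ⁻¹ * permOp τ) * C * permOp τ⁻¹ := by
        rw [hC, mul_one]; simp only [mul_assoc]
    _ = permOp τ * (Cᴴ * C) * permOp τ⁻¹ := by rw [h1, mul_one]; simp only [mul_assoc]
    _ = 1 := by rw [hC, mul_one, h2]

theorem withTranslate_conj {σ τ : Equiv.Perm X} (hc : τ * σ = σ * τ) (C : Op X q) :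
    withTranslate τ (permOp σ * C * (permOp σ)ᴴ) =
      permOp σ * withTranslate τ C * (permOp σ)ᴴ := by
  have h1 : (permOp τ : Op X q) * permOp σ = permOp σ * permOp τ := by
    rw [← permOp_mul, hc, permOp_mul]
  have h2 : (permOp σ⁻¹ : Op X q) * permOp τ⁻¹ = permOp τ⁻¹ * permOp σ⁻¹ := by
    rw [← permOp_mul, ← permOp_mul, ← _root_.mul_inv_rev, ← _root_.mul_inv_rev, hc]
  have h3 : (permOp σ⁻¹ : Op X q) * permOp σ = 1 := by
    rw [← permOp_mul, inv_mul_cancel, permOp_one]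
  rw [permOp_conjTranspose]
  calc withTranslate τ (permOp σ * C * permOp σ⁻¹)
      = permOp σ * C * permOp σ⁻¹ * (permOp τ * permOp σ) * C *
          (permOp σ⁻¹ * permOp τ⁻¹) := by
        simp only [withTranslate, mul_assoc]
    _ = permOp σ * C * (permOp σ⁻¹ * permOp σ) * permOp τ * C * permOp τ⁻¹ * permOp σ⁻¹ := by
        rw [h1, h2]; simp only [mul_assoc]
    _ = _ := by rw [h3, mul_one]; simp only [withTranslate, mul_assoc]

/-- An almost equal split: `m` for `n = 2 * m + 1`, and the odd number `2 * l - 1` for `n = 4 * l`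
and for `n = 4 * l + 2`, except that `n = 2` uses 1. The tightest case is `n = 4 * l + 2` with `l`
positive, which needs `8 * k + 4 < n`; for `k ≥ 1` this follows from `13 * k < n`. -/
theorem exists_coprime_split {n k : ℕ} (hn : 2 ≤ n) (h : 13 * k < n) :
    ∃ a, 4 * k < a ∧ a + 4 * k < n ∧ a.Coprime n := by
  rcases Nat.even_or_odd' n with ⟨m, rfl | rfl⟩
  · rcases Nat.even_or_odd' m with ⟨l, rfl | rfl⟩
    · refine ⟨2 * l - 1, by omega, by omega, ?_⟩
      obtain ⟨l, rfl⟩ : ∃ i, l = i + 1 := ⟨l - 1, by omega⟩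
      rw [show 2 * (l + 1) - 1 = 2 * l + 1 by omega,
        show 2 * (2 * (l + 1)) = 2 + (2 * l + 1) * 2 by ring, Nat.coprime_add_mul_left_right]
      exact Nat.coprime_two_right.2 ⟨l, rfl⟩
    · rcases Nat.eq_zero_or_pos l with rfl | hl
      · exact ⟨1, by omega, by omega, by simp⟩
      · refine ⟨2 * l - 1, by omega, by omega, ?_⟩
        obtain ⟨l, rfl⟩ : ∃ i, l = i + 1 := ⟨l - 1, by omega⟩
        rw [show 2 * (l + 1) - 1 = 2 * l + 1 by omega,
          show 2 * (2 * (l + 1) + 1) = 2 ^ 2 + (2 * l + 1) * 2 by ring,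
          Nat.coprime_add_mul_left_right]
        exact (Nat.coprime_two_right.2 ⟨l, rfl⟩).pow_right 2
  · refine ⟨m, by omega, by omega, ?_⟩
    rw [show 2 * m + 1 = 1 + m * 2 by ring, Nat.coprime_add_mul_left_right]
    exact Nat.coprime_one_right m

theorem pow_eq_one_of_permOp {σ : Equiv.Perm X} {χ : StateVec X q} {z : ℂ}
    (h : permOp σ *ᵥ χ = z • χ) (hχ : χ ≠ 0) {k : ℕ} (hk : σ ^ k = 1) : z ^ k = 1 := by
  have h1 := permOp_pow_mulVec h k
  rw [hk, permOp_one, one_mulVec] at h1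
  obtain ⟨c, hc⟩ := Function.ne_iff.1 hχ
  have h2 := congrFun h1 c
  simp only [Pi.smul_apply, smul_eq_mul] at h2
  have h3 : (z ^ k - 1) * χ c = 0 := by rw [sub_mul, ← h2, one_mul, sub_self]
  exact sub_eq_zero.1 ((mul_eq_zero.1 h3).resolve_right hc)

/-- A short-range entangled state on the ring of length `n = a + b` yields an eigenvector, with
the same eigenvalue, of the translation of two rings of lengths `a` and `b`. -/
theorem IsCircuit.pow_mul_eq_one [NeZero n] [NeZero q] {r D : ℕ}
    {U : unitaryGroup (Config X q) ℂ}
    (h : IsCircuit p r D U) {ψ : StateVec X q} (hψ : (U : Op X q) *ᵥ ψ = zeroState X q)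
    (hψ1 : star ψ ⬝ᵥ ψ = 1) {σ : Equiv.Perm X} (hp : ∀ x, p (σ x) = p x + 1) (hσn : σ ^ n = 1)
    {z : ℂ} (hz : z ≠ 0) (hσ : permOp σ *ᵥ ψ = z • ψ)
    {a b : ℕ} (ha : 4 * (r * D) < a) (hb : 4 * (r * D) < b) (hab : a + b = n) :
    z ^ (a * b) = 1 := by
  have ha' : 4 * ((r : ℤ) * D) < a := by exact_mod_cast ha
  have hb' : 4 * ((r : ℤ) * D) < b := by exact_mod_cast hb
  obtain ⟨C, hC, hx⟩ := h.exists_dressedSwap hψ hψ1 hp hz hσ (a := (a : ℤ)) ha' (by omega)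
  have hρ : (0 : ℤ) ≤ r * D := by positivity
  set ρ : ℤ := r * D with hρdef
  set T : Op X q := permOp σ with hT
  have hTT : Tᴴ * T = 1 := permOp_conjTranspose_mul_self σ
  set τ : Equiv.Perm X := σ ^ a with hτ
  have hc : τ * σ = σ * τ := (Commute.pow_self σ a).eq
  set C₁ : Op X q := T * (C : Op X q) * Tᴴ with hC₁
  have hU : (C : Op X q)ᴴ * (C : Op X q) = 1 := Unitary.coe_star_mul_self C
  have hU₁ : C₁ᴴ * C₁ = 1 := permOp_conj_conjTranspose_mul_self σ hU
  have hτp : ∀ x ∈ arc p (-ρ) (ρ + 1), τ x ∈ arc p (-ρ + a) (ρ + 1 + a) := fun x hx =>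
    (pow_apply_mem_arc hp a).2 hx
  have hd : ∀ x ∈ arc p (-ρ) (ρ + 1), τ x ∉ arc p (-ρ) (ρ + 1) := fun x hx hx' =>
    Finset.disjoint_left.1 (arc_disjoint (p := p) (u := -ρ) (v := ρ + 1) (u' := -ρ + a)
      (v' := ρ + 1 + a) (by omega) (by omega)) hx' (hτp x hx)
  have hB : ∀ {u v : ℤ}, -ρ ≤ u → v ≤ ρ + 1 → arc p u v ⊆ arc p (-ρ) (ρ + 1) :=
    fun hu hv => arc_mono hu hv
  have hB0 : arc p 0 (ρ + 1) ⊆ arc p (-ρ) (ρ + 1) := hB (by omega) le_rfl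
  have hB1 : arc p 1 (ρ + 1) ⊆ arc p (-ρ) (ρ + 1) := hB (by omega) le_rfl
  have hB0' : arc p 0 ρ ⊆ arc p (-ρ) (ρ + 1) := hB (by omega) (by omega)
  have hBρ : arc p ρ (ρ + 1) ⊆ arc p (-ρ) (ρ + 1) := hB (by omega) le_rfl
  have hsw : ∀ {B : Finset X}, B ⊆ arc p (-ρ) (ρ + 1) → ∀ x ∈ B, τ x ∉ B :=
    fun hB x hx hx' => hd x (hB hx) (hB hx')
  obtain ⟨c, hcC⟩ : SupportedOn (arc p (-ρ) (ρ + 1)) (C : Op X q) :=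
    hC.mono (arc_mono le_rfl (by omega))
  obtain ⟨c₁, hcC₁⟩ : SupportedOn (arc p (-ρ) (ρ + 1)) C₁ := by
    rw [hC₁, hT, permOp_conjTranspose]
    exact hC.conj_permOp σ fun y hy => arc_mono (by omega) le_rfl ((apply_mem_arc hp).2 hy)
  set E : Op X q := withTranslate τ (C : Op X q) with hE
  have hE₁ : withTranslate τ C₁ = T * E * Tᴴ := withTranslate_conj hc _
  have hEE : Eᴴ * E = 1 := withTranslate_conjTranspose_mul_self hU
  -- the exchange of one copy with its translate, dressed at the left end
  let P (B : Finset X) (hB : B ⊆ arc p (-ρ) (ρ + 1)) : Op X q := permOp (pairSwap τ B (hsw hB))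
  set Z₀ : Op X q := Eᴴ * P _ hB0 * E with hZ₀
  set Z₁ : Op X q := (withTranslate τ C₁)ᴴ * P _ hB1 * withTranslate τ C₁ with hZ₁
  have hPP : ∀ {B} (hB), P B hB * P B hB = 1 := fun hB => by
    change permOp _ * permOp _ = 1
    rw [← permOp_mul, pairSwap_mul_self, permOp_one]
  have hPH : ∀ {B} (hB), (P B hB)ᴴ = P B hB := fun hB => by
    change (permOp _)ᴴ = permOp _
    rw [permOp_conjTranspose, inv_eq_of_mul_eq_one_left (pairSwap_mul_self _ _ _)]
  have hE₁u : (withTranslate τ C₁)ᴴ * withTranslate τ C₁ = 1 :=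
    withTranslate_conjTranspose_mul_self hU₁
  have hZ₀u : Z₀ᴴ * Z₀ = 1 := conj_conjTranspose_mul_self hEE (by rw [hPH hB0, hPP hB0])
  have hZ₁u : Z₁ᴴ * Z₁ = 1 := conj_conjTranspose_mul_self hE₁u (by rw [hPH hB1, hPP hB1])
  have hinvol : Z₁ * Z₁ = 1 := by rw [hZ₁, conj_mul_conj hE₁u, hPP hB1, mul_one, hE₁u]
  -- One local operator on `N ⊕ N` is evaluated in two realisations: on `N` and its translate within
  -- `ψ`, and on two copies of `N` in `ψ ⊗ ψ`, where the value is known.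
  have hexp : expect ψ (Z₁ * Z₀) = 1 := by
    have h0 := embedOp_withImage_dressedSwap hB0 hd c
    have h1 := embedOp_withImage_dressedSwap hB1 hd c₁
    rw [hcC] at h0
    rw [hcC₁] at h1
    rw [hZ₁, hZ₀, ← h1, ← h0, ← embedOp_mul (withImage_injective hd),
      h.expect_withImage hψ hψ1 (pow_ne_zero a hz) (permOp_pow_mulVec hσ a) hτp (by omega)
        (by omega) hd, embedOp_mul (sumMap_val_injective _), embedOp_dressedSwap hB1,
      embedOp_dressedSwap hB0, hcC, hcC₁, hx]
  have hfix : (Z₁ * Z₀) *ᵥ ψ = ψ := by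
    refine mulVec_eq_self_of_expect_eq_one hψ1 ?_ hexp
    calc (Z₁ * Z₀)ᴴ * (Z₁ * Z₀) = Z₀ᴴ * (Z₁ᴴ * Z₁) * Z₀ := by
          simp only [conjTranspose_mul, mul_assoc]
      _ = 1 := by rw [hZ₁u, mul_one, hZ₀u]
  have hZZ : Z₀ *ᵥ ψ = Z₁ *ᵥ ψ := by
    conv_rhs => rw [← hfix]
    rw [mulVec_mulVec, ← mul_assoc, hinvol, one_mul]
  set Pρ : Op X q := P _ hBρ with hPρ
  -- The slab at `ρ` lies just beyond the dressing, which is supported on `[-ρ, ρ)`, and its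
  -- translate just beyond the translated dressing.
  have hPρE : Commute Pρ E := by
    have hfixρ : ∀ x, x ∉ arc p ρ (ρ + 1) → x ∉ arc p (ρ + a) (ρ + 1 + a) →
        pairSwap τ (arc p ρ (ρ + 1)) (hsw hBρ) x = x := by
      intro x h1 h2
      rw [pairSwap_apply, if_neg h1, if_neg]
      intro h3
      refine h2 ?_
      have := (pow_apply_mem_arc hp a).2 h3
      rwa [← hτ, Equiv.apply_symm_apply] at this
    obtain ⟨c', hc'⟩ := hC
    obtain ⟨d', hd'⟩ := SupportedOn.conj_permOp (T := arc p (-ρ + a) (ρ + a)) (M := (C : Op X q))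
      ⟨c', hc'⟩ τ (fun x hx => (pow_apply_mem_arc hp a).2 hx)
    rw [hE, withTranslate]
    refine Commute.mul_right ?_ ?_
    · rw [← hc']
      refine commute_permOp_embedOp Subtype.val_injective (fun s => hfixρ _ ?_ ?_) _
      · exact Finset.disjoint_left.1 (arc_disjoint (by omega) (by omega)) s.2
      · exact Finset.disjoint_left.1 (arc_disjoint (by omega) (by omega)) s.2
    · rw [← hd']
      refine commute_permOp_embedOp Subtype.val_injective (fun s => hfixρ _ ?_ ?_) _
      · exact Finset.disjoint_right.1 (arc_disjoint (by omega) (by omega)) s.2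
      · exact Finset.disjoint_left.1 (arc_disjoint (by omega) (by omega)) s.2
  have hPρ2 : Pρ * Pρ = 1 := hPP hBρ
  have hsplit : P _ hB0 = P _ hB0' * Pρ := by
    have h1 := permOp_pairSwap_union (q := q) hB0' hBρ hd (arc_disjoint (by omega) (by omega))
    rw [hPρ]
    change permOp _ = permOp _ * permOp _
    rw [← h1]
    congr 2
    exact (arc_union (by omega) (by omega)).symm
  have hPT : P _ hB1 * T = T * P _ hB0' := by
    change permOp _ * permOp _ = permOp _ * permOp _
    rw [← permOp_mul, ← permOp_mul, pairSwap_conj (B := arc p 0 ρ)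
      (fun x => by rw [← Equiv.Perm.mul_apply, hc, Equiv.Perm.mul_apply])]
    exact fun x => by simpa using apply_mem_arc hp (u := 0) (v := ρ) (x := x)
  -- Removing the last slab from `[0, ρ + 1)` and translating gives `[1, ρ + 1)`.
  have hZ₁' : Z₁ = T * (Z₀ * Pρ) * Tᴴ := by
    calc Z₁ = T * Eᴴ * Tᴴ * (P _ hB1 * T) * E * Tᴴ := by
          rw [hZ₁, hE₁]
          simp only [conjTranspose_mul, conjTranspose_conjTranspose, mul_assoc]
      _ = T * Eᴴ * (Tᴴ * T) * P _ hB0' * E * Tᴴ := by rw [hPT]; simp only [mul_assoc]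
      _ = T * Eᴴ * P _ hB0' * (Pρ * Pρ) * E * Tᴴ := by rw [hTT, hPρ2, mul_one, mul_one]
      _ = T * Eᴴ * (P _ hB0' * Pρ) * (Pρ * E) * Tᴴ := by simp only [mul_assoc]
      _ = T * (Z₀ * Pρ) * Tᴴ := by
          rw [← hsplit, hPρE.eq, hZ₀]; simp only [mul_assoc]
  have hcomm : Z₀ * Pρ = Pρ * Z₀ := by
    have hPE' : Commute Pρ Eᴴ := by
      have : Commute (Pρᴴ) (Eᴴ) := by
        rw [Commute, SemiconjBy, ← conjTranspose_mul, ← conjTranspose_mul, hPρE.eq]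
      rwa [hPH hBρ] at this
    have hPP0 : Commute Pρ (P _ hB0') := by
      have h1 := permOp_pairSwap_union (q := q) hB0' hBρ hd (arc_disjoint (by omega) (by omega))
      have h2 := permOp_pairSwap_union (q := q) hBρ hB0' hd
        (arc_disjoint (by omega) (by omega)).symm
      have h3 : Pρ * P _ hB0' = P _ hB0' * Pρ := by
        rw [hPρ]
        change permOp _ * permOp _ = permOp _ * permOp _
        rw [← h1, ← h2]
        congr 2
        exact Finset.union_comm _ _
      exact h3
    have : Commute Pρ Z₀ := by
      rw [hZ₀, hsplit]
      exact (hPE'.mul_right (hPP0.mul_right (Commute.refl _))).mul_right hPρE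
    exact this.eq.symm
  have hTψ : Tᴴ *ᵥ ψ = z⁻¹ • ψ := by
    rw [hT, permOp_conjTranspose]
    exact permOp_inv_mulVec hz hσ
  -- Inserting the relation between `Z₁` and `Z₀` into `Z₀ ψ = Z₁ ψ`, the factor `Tᴴ` acts on `ψ` as
  -- `z⁻¹` and what remains is `T * Pρ` applied to `Z₀ ψ`.
  have hχ : (T * Pρ) *ᵥ (Z₀ *ᵥ ψ) = z • (Z₀ *ᵥ ψ) := by
    have h1 : Z₀ *ᵥ ψ = z⁻¹ • ((T * Pρ) *ᵥ (Z₀ *ᵥ ψ)) := by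
      conv_lhs => rw [hZZ, hZ₁', ← mulVec_mulVec, hTψ, mulVec_smul, hcomm, ← mul_assoc,
        ← mulVec_mulVec]
    conv_rhs => rw [h1, smul_smul, mul_inv_cancel₀ hz, one_smul]
  have hχ0 : Z₀ *ᵥ ψ ≠ 0 := by
    intro h0
    have h1 : Z₀ᴴ *ᵥ (Z₀ *ᵥ ψ) = ψ := by rw [mulVec_mulVec, hZ₀u, one_mulVec]
    rw [h0, mulVec_zero] at h1
    rw [← h1] at hψ1
    simp at hψ1
  have hperm : permOp (σ * pairSwap (σ ^ a) (arc p ρ (ρ + 1)) (hsw hBρ)) *ᵥ (Z₀ *ᵥ ψ) =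
      z • (Z₀ *ᵥ ψ) := by
    rw [permOp_mul]
    exact hχ
  exact pow_eq_one_of_permOp hperm hχ0
    (reconnect_pow_eq_one hp hσn (by omega) (by omega) hab ρ (hsw hBρ))

/-- A translation eigenvector that a shallow circuit maps to a product state has eigenvalue `1`. -/
theorem IsCircuit.eigenvalue_eq_one [NeZero n] [NeZero q] {r D : ℕ}
    {U : unitaryGroup (Config X q) ℂ}
    (h : IsCircuit p r D U) {ψ : StateVec X q} (hψ : (U : Op X q) *ᵥ ψ = zeroState X q)
    {σ : Equiv.Perm X} (hp : ∀ x, p (σ x) = p x + 1) (hσn : σ ^ n = 1)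
    {z : ℂ} (hz : z ≠ 0) (hσ : permOp σ *ᵥ ψ = z • ψ) (hn : 13 * (r * D) < n) : z = 1 := by
  have hUU : (U : Op X q)ᴴ * (U : Op X q) = 1 := Unitary.coe_star_mul_self U
  have hψ1 : star ψ ⬝ᵥ ψ = 1 := by
    have h1 := expect_conj ψ (U : Op X q) 1
    rw [mul_one, hUU, hψ, expect_zeroState, Matrix.one_apply_eq, expect, one_mulVec] at h1
    exact h1
  have hψ0 : ψ ≠ 0 := by
    rintro rfl
    simp at hψ1
  have hzn := pow_eq_one_of_permOp hσ hψ0 hσn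
  rcases Nat.lt_or_ge n 2 with h2 | h2
  · have : n = 1 := by have := NeZero.ne n; omega
    rw [this, pow_one] at hzn
    exact hzn
  · obtain ⟨a, ha, hb, hcop⟩ := exists_coprime_split h2 hn
    obtain ⟨b, hab⟩ : ∃ b, a + b = n := ⟨n - a, by omega⟩
    have hzab := h.pow_mul_eq_one hψ hψ1 hp hσn hz hσ ha (b := b) (by omega) hab
    have hcop' : b.Coprime n := by
      rw [← hab] at hcop ⊢
      have h1 : a.Coprime b := by simpa using hcop
      simpa using h1.symm
    have h3 := pow_gcd_eq_one.2 ⟨hzab, hzn⟩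
    rwa [(Nat.Coprime.mul_left hcop hcop'), pow_one] at h3

end Momentum

/-! ### From circuits on the torus to circuits along one direction -/

section Torus

set_option linter.unusedSectionVars false

theorem Gate.toMatrix_eq_embedOp {X : Type} [Fintype X] [DecidableEq X] {q : ℕ} (g : Gate X q) :
    g.toMatrix = embedOp (Subtype.val : g.support → X) (g.unitary : Op g.support q) := by
  ext a b
  simp only [Gate.toMatrix, embedOp, of_apply]
  exact if_congr (by simp) rfl rfl

theorem Gate.toMatrix_mem {X : Type} [Fintype X] [DecidableEq X] {q : ℕ} (g : Gate X q) :
    g.toMatrix ∈ unitaryGroup (Config X q) ℂ := by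
  have h : (g.unitary : Op g.support q) * (g.unitary : Op g.support q)ᴴ = 1 :=
    Unitary.coe_mul_star_self g.unitary
  rw [mem_unitaryGroup_iff, star_eq_conjTranspose, g.toMatrix_eq_embedOp, ← embedOp_conjTranspose,
    ← embedOp_mul Subtype.val_injective, h, embedOp_one Subtype.val_injective]

variable {d : ℕ} {L : Fin d → ℕ} [∀ i, NeZero (L i)] {q : ℕ}

theorem Gate.HasRange.isNarrow {g : Gate (Torus L) q} {r : ℕ} (h : g.HasRange r) (j : Fin d) :
    IsNarrow (fun x : Torus L => x j) r g.support := by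
  intro x hx y hy
  have h1 : (x j - y j).valMinAbs.natAbs ≤ r := h x hx y hy j
  exact ⟨(x j - y j).valMinAbs, by omega, by omega, by rw [ZMod.coe_valMinAbs]; ring⟩

/-- Only the coordinate in direction `j` is retained; the transverse extent of a gate is irrelevant
to the argument. -/
theorem IsLocalUnitary.exists_isCircuit {r D : ℕ}
    {U : Matrix (Config (Torus L) q) (Config (Torus L) q) ℂ} (h : IsLocalUnitary r D U)
    (j : Fin d) : ∃ u : unitaryGroup (Config (Torus L) q) ℂ,
      (u : Op (Torus L) q) = U ∧ IsCircuit (fun x : Torus L => x j) r D u := by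
  obtain ⟨c, h1, h2, rfl⟩ := h
  let gu : Gate (Torus L) q → unitaryGroup (Config (Torus L) q) ℂ :=
    fun g => ⟨g.toMatrix, g.toMatrix_mem⟩
  refine ⟨layeredProd (c.map fun l => l.gates.map gu), ?_, _, ?_, ?_, ?_, rfl⟩
  · clear h1 h2
    induction c with
    | nil => rfl
    | cons l c ih =>
      rw [List.map_cons, layeredProd, circuitMatrix, ← ih, Layer.toMatrix, Submonoid.coe_mul,
        Submonoid.coe_list_prod, List.map_map]
      rfl
  · simpa using h1
  · intro l hl
    obtain ⟨l, hl, rfl⟩ := List.mem_map.1 hl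
    rw [List.pairwise_map]
    refine l.disjoint.imp fun {g g'} hgg' => Subtype.ext ?_
    exact SupportedOn.commute ⟨_, g.toMatrix_eq_embedOp.symm⟩ ⟨_, g'.toMatrix_eq_embedOp.symm⟩
      hgg'
  · intro l hl u hu
    obtain ⟨l', hl', rfl⟩ := List.mem_map.1 hl
    obtain ⟨g, hg, rfl⟩ := List.mem_map.1 hu
    exact ⟨g.support, ⟨_, g.toMatrix_eq_embedOp.symm⟩, (h2 l' hl' g hg).isNarrow j⟩

theorem latticeTranslate_eq_permOp (j : Fin d) (ψ : StateVec (Torus L) q) :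
    latticeTranslate j ψ =
      permOp (Equiv.addRight (Pi.single j 1 : Torus L)) *ᵥ ψ := by
  funext a
  rw [permOp_mulVec]
  rfl

theorem addRight_single_pow (j : Fin d) :
    (Equiv.addRight (Pi.single j 1 : Torus L)) ^ L j = 1 := by
  have h : ∀ (k : ℕ) (x : Torus L),
      ((Equiv.addRight (Pi.single j 1 : Torus L)) ^ k) x = x + k • Pi.single j 1 := by
    intro k
    induction k with
    | zero => simp
    | succ k ih =>
      intro x
      rw [pow_succ', Equiv.Perm.mul_apply, ih, succ_nsmul, ← add_assoc]
      rfl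
  ext1 x
  rw [h, ← Pi.single_smul]
  simp

/-- A state with momentum `P` that a shallow circuit maps to a product state has `e^{iP} = 1`. -/
theorem HasMomentum.exp_eq_one [NeZero q] {j : Fin d} {P : ℝ} {ψ : StateVec (Torus L) q}
    (h : HasMomentum j P ψ) {r D : ℕ} {u : unitaryGroup (Config (Torus L) q) ℂ}
    (hu : IsCircuit (fun x : Torus L => x j) r D u) {w : ℂ}
    (hψ : (u : Op (Torus L) q) *ᵥ ψ = w • zeroState (Torus L) q) (hL : 13 * (r * D) < L j) :
    Complex.exp (P * Complex.I) = 1 := by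
  obtain ⟨h0, hT⟩ := h
  rw [latticeTranslate_eq_permOp] at hT
  have hw : w ≠ 0 := by
    rintro rfl
    have huu : (u : Op (Torus L) q)ᴴ * (u : Op (Torus L) q) = 1 := Unitary.coe_star_mul_self u
    refine h0 ?_
    rw [← one_mulVec ψ, ← huu, ← mulVec_mulVec, hψ, zero_smul, mulVec_zero]
  refine hu.eigenvalue_eq_one (ψ := w⁻¹ • ψ) ?_
    (σ := Equiv.addRight (Pi.single j 1 : Torus L)) (fun x => ?_) (addRight_single_pow j)
    (Complex.exp_ne_zero _) ?_ hL
  · rw [mulVec_smul, hψ, smul_smul, inv_mul_cancel₀ hw, one_smul]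
  · simp
  · rw [mulVec_smul, hT, smul_comm]

end Torus

end SpinLattice

theorem theorem1 :
    ∃ C : ℕ, ∀ (d : ℕ) (L : Fin d → ℕ) [∀ i, NeZero (L i)] (q : ℕ) [NeZero q] (j : Fin d)
      (r D : ℕ), C * (r * D) < L j →
      (∀ (P : ℝ) (ψ : SpinLattice.StateVec (SpinLattice.Torus L) q),
        SpinLattice.HasMomentum j P ψ → Complex.exp (P * Complex.I) ≠ 1 →
          SpinLattice.IsLongRangeEntangled r D ψ) ∧
      (∀ (P P' : ℝ) (ψ : SpinLattice.StateVec (SpinLattice.Torus L) q)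
        (U : Matrix (SpinLattice.Config (SpinLattice.Torus L) q)
          (SpinLattice.Config (SpinLattice.Torus L) q) ℂ),
        SpinLattice.IsLocalUnitary r D U →
        SpinLattice.HasMomentum j P ψ → SpinLattice.HasMomentum j P' (U.mulVec ψ) →
        Complex.exp (P' * Complex.I) ≠ Complex.exp (P * Complex.I) →
          SpinLattice.IsLongRangeEntangled r D ψ) := by
  -- The second claim applies the eigenvalue bound to `U ψ` with the circuit `V * U⁻¹`, of depth `2
  -- * D`, so the constant 13 is doubled. Both phases are then 1.
  refine ⟨26, fun d L _ q _ j r D hL => ⟨?_, ?_⟩⟩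
  · rintro P ψ hψ hP ⟨V, hV, w, hw⟩
    obtain ⟨v, rfl, hv⟩ := hV.exists_isCircuit j
    exact hP (hψ.exp_eq_one hv hw (by omega))
  · rintro P P' ψ U hU hψ hψ' hPP' ⟨V, hV, w, hw⟩
    obtain ⟨v, rfl, hv⟩ := hV.exists_isCircuit j
    obtain ⟨u, rfl, hu⟩ := hU.exists_isCircuit j
    refine hPP' ?_
    rw [hψ.exp_eq_one hv hw (by omega)]
    refine hψ'.exp_eq_one (hu.inv.mul hv) (w := w) ?_
      (by rw [show r * (D + D) = 2 * (r * D) by ring]; omega)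
    rw [Matrix.mulVec_mulVec, ← Submonoid.coe_mul, inv_mul_cancel_right]
    exact hw
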